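/- Let $H,K,E$ be separable real Hilbert spaces, with $K$ embedded in $E$ by an injective Hilbert–Schmidt operator $j:K\to E$. Let $\Omega$ be the space of continuous paths $\omega:\mathbb R\to E$ with $\omega(0)=0$, with the compact-open topology and its Borel $\sigma$-algebra $\mathcal F$, let $W(t,\omega)=\omega(t)$, and let $P$ be Wiener measure on $\Omega$ with covariance space $K$: under $P$ the process $(W(t))_{t\in\mathbb R}$ has independent increments, and for $s\le t$ the increment $W(t)-W(s)$ is a centered Gaussian vector with covariance operator $(t-s)jj^*$. Let $\theta(t,\omega)(s)=\omega(t+s)-\omega(t)$. Let $A$ be a self-adjoint operator on $H$ with $A\ge cI$ for some $c\in\mathbb R$, such that $H$ has an orthonormal basis $(e_n)$ with $Ae_n=\mu_ne_n$ and all $\mu_n\neq 0$, and such that $A$ has a bounded trace-class inverse $A^{-1}$. Let $T_t=e^{-At}$, $t\ge 0$, be the strongly continuous semigroup generated by $-A$. Assume that $A$ has negative and positive eigenvalues; let $\mu_m$ be the largest negative eigenvalue of $A$ and $\mu_{m+1}$ the smallest positive one. Let $H^-$ and $H^+$ be the closed linear spans of the eigenvectors of $A$ with negative and positive eigenvalues,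 $p^\pm$ the orthogonal projections of $H$ onto $H^\pm$, and $T_{-t}:=[T_t|_{H^-}]^{-1}$ on $H^-$ for $t\ge 0$. Let $B_0:K\to H$ be a Hilbert–Schmidt operator, and let $F:H\to H$ be bounded with $|F(v_1)-F(v_2)|\le L|v_1-v_2|$ for all $v_1,v_2\in H$, where $$L\,[\mu_{m+1}^{-1}-\mu_m^{-1}]<1. \tag{4.3}$$ **Proposition 4.1.** The stochastic integrals $$\int_{-\infty}^0T_{-s}p^+B_0\,dW(s),\qquad \int_0^\infty T_{-s}p^-B_0\,dW(s)$$ (the $L^2(P;H)$-limits of the integrals of elementary integrands $\sum_i 1_{(a_i,b_i]}S_i$, $S_i\in L(E,H)$, converging to the integrand in $L^2(\mathbb R;L_2(K,H))$) exist. For every choice of everywhere defined $\mathcal F$-measurable versions $\omega\mapsto(\omega)\int_{-\infty}^0T_{-s}p^+B_0\,dW(s)$ and $\omega\mapsto(\omega)\int_0^{\infty}T_{-s}p^-B_0\,dW(s)$ of them, there is exactly one $\mathcal F$-measurable map $Y:\Omega\to H$ such that, for all $\omega\in\Omega$, the first two integrals below converge as Bochner integrals and $$\begin{aligned}Y(\omega)={}&\int_{-\infty}^0T_{-s}p^+F(Y(\theta(s,\omega)))\,ds-\int_0^\infty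 T_{-s}p^-F(Y(\theta(s,\omega)))\,ds\\&+(\omega)\int_{-\infty}^0T_{-s}p^+B_0\,dW(s)-(\omega)\int_0^\infty T_{-s}p^-B_0\,dW(s).\end{aligned}\tag{4.4}$$ -/

import Mathlib

open MeasureTheory ProbabilityTheory Set Filter Topology
open scoped ENNReal NNReal InnerProductSpace

noncomputable section

/-! ### Hilbert–Schmidt operators -/

section Operators

variable {K H : Type*} [NormedAddCommGroup K] [InnerProductSpace ℝ K] [CompleteSpace K]
  [NormedAddCommGroup H] [InnerProductSpace ℝ H]

/-- The squared Hilbert–Schmidt norm `∑ ‖S f_k‖²` in `[0, ∞]`, computed in an orthonormal basis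
`(f_k)` of `K`. It does not depend on the basis, see `hsNormSq_eq_tsum`. -/
def hsNormSq (S : K →L[ℝ] H) : ℝ≥0∞ :=
  ∑' f : (exists_hilbertBasis ℝ K).choose, ‖S (f : K)‖ₑ ^ 2

/-- `S ∈ L₂(K, H)`: the operator `S` is Hilbert–Schmidt. -/
def IsHilbertSchmidtOp (S : K →L[ℝ] H) : Prop := hsNormSq S < ∞

theorem enorm_sq_eq_tsum_inner {ι : Type*} (b : HilbertBasis ι ℝ K) (x : K) :
    ‖x‖ₑ ^ 2 = ∑' i, ‖⟪b i, x⟫_ℝ‖ₑ ^ 2 := by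
  have h := b.hasSum_inner_mul_inner x x
  rw [real_inner_self_eq_norm_sq] at h
  have h' : HasSum (fun i => ‖⟪b i, x⟫_ℝ‖ ^ 2) (‖x‖ ^ 2) :=
    h.congr_fun fun i => by rw [real_inner_comm x (b i), Real.norm_eq_abs, sq_abs, sq]
  have h2 := ENNReal.ofReal_tsum_of_nonneg (fun i => by positivity) h'.summable
  rw [h'.tsum_eq] at h2
  simpa only [ENNReal.ofReal_pow (norm_nonneg _), ofReal_norm] using h2

theorem tsum_enorm_sq_eq_adjoint [CompleteSpace H] {ι κ : Type*} (b : HilbertBasis ι ℝ K)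
    (g : HilbertBasis κ ℝ H) (S : K →L[ℝ] H) :
    ∑' i, ‖S (b i)‖ₑ ^ 2 = ∑' k, ‖S.adjoint (g k)‖ₑ ^ 2 := by
  simp_rw [enorm_sq_eq_tsum_inner g (S _), enorm_sq_eq_tsum_inner b (S.adjoint _)]
  rw [ENNReal.tsum_comm]
  refine tsum_congr fun k => tsum_congr fun i => ?_
  rw [ContinuousLinearMap.adjoint_inner_right, real_inner_comm]

theorem hsNormSq_eq_tsum [CompleteSpace H] {ι : Type*} (b : HilbertBasis ι ℝ K)
    (S : K →L[ℝ] H) : hsNormSq S = ∑' i, ‖S (b i)‖ₑ ^ 2 := by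
  obtain ⟨w, g, -⟩ := exists_hilbertBasis ℝ H
  obtain ⟨b₀, hb₀⟩ := (exists_hilbertBasis ℝ K).choose_spec
  rw [tsum_enorm_sq_eq_adjoint b g, ← tsum_enorm_sq_eq_adjoint b₀ g, hb₀]
  rfl

end Operators

/-! ### Trace-class operators, unbounded operators, semigroups, spectral subspaces -/

section Unbounded

variable {H : Type*} [NormedAddCommGroup H] [InnerProductSpace ℝ H]

/-- A bounded operator is trace-class (nuclear) if it is a sum of rank-one operators
`x ↦ ⟪a n, x⟫ b n` with `∑ ‖a n‖ ‖b n‖ < ∞`. -/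
def IsTraceClassOp (R : H →L[ℝ] H) : Prop :=
  ∃ a b : ℕ → H, Summable (fun n => ‖a n‖ * ‖b n‖) ∧
    ∀ x, HasSum (fun n => ⟪a n, x⟫_ℝ • b n) (R x)

/-- The unbounded operator `A` is a bijection of its domain onto `H`, with bounded inverse `R`. -/
def IsBoundedInverse (A : H →ₗ.[ℝ] H) (R : H →L[ℝ] H) : Prop :=
  ∀ x y : H, (x, y) ∈ A.graph ↔ R y = x

/-- The vector `x` lies in the domain of `A` and `A x = l x`. -/
def IsEigenpair (A : H →ₗ.[ℝ] H) (l : ℝ) (x : H) : Prop := (x, l • x) ∈ A.graph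

/-- `l` is an eigenvalue of the unbounded operator `A`. -/
def IsEigenvalue (A : H →ₗ.[ℝ] H) (l : ℝ) : Prop := ∃ x : H, x ≠ 0 ∧ IsEigenpair A l x

/-- `T_t`, `t ≥ 0`, is a strongly continuous semigroup of bounded operators and its infinitesimal
generator is `G`, domain included. Values of `T` at negative times play no role. -/
structure IsC0SemigroupGeneratedBy (T : ℝ → H →L[ℝ] H) (G : H →ₗ.[ℝ] H) : Prop where
  zero : T 0 = ContinuousLinearMap.id ℝ H
  add : ∀ s t, 0 ≤ s → 0 ≤ t → T (s + t) = T s ∘L T t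
  continuousOn : ∀ x, ContinuousOn (fun t => T t x) (Ici 0)
  generator : ∀ x y, (x, y) ∈ G.graph ↔
    Tendsto (fun t : ℝ => t⁻¹ • (T t x - x)) (𝓝[>] 0) (𝓝 y)

/-- `H⁺`: the closed span of the eigenvectors of `A` with positive eigenvalue. -/
abbrev posSpace (A : H →ₗ.[ℝ] H) : Submodule ℝ H :=
  (Submodule.span ℝ {x | ∃ l, 0 < l ∧ IsEigenpair A l x}).topologicalClosure

/-- `H⁻`: the closed span of the eigenvectors of `A` with negative eigenvalue. -/
abbrev negSpace (A : H →ₗ.[ℝ] H) : Submodule ℝ H :=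
  (Submodule.span ℝ {x | ∃ l, l < 0 ∧ IsEigenpair A l x}).topologicalClosure

variable [CompleteSpace H]

/-- `T_t p⁺` for `t ≥ 0`, where `p⁺` is the orthogonal projection onto `H⁺`. -/
def fwd (A : H →ₗ.[ℝ] H) (T : ℝ → H →L[ℝ] H) (t : ℝ) : H →L[ℝ] H :=
  T t ∘L (posSpace A).starProjection

/-- The restriction of `T_t` to `H⁻`, as an operator of `H⁻` (since `H⁻` is invariant under
`T_t`, the projection that brings the values back into `H⁻` changes nothing). -/
def restrNeg (A : H →ₗ.[ℝ] H) (T : ℝ → H →L[ℝ] H) (t : ℝ) : negSpace A →L[ℝ] negSpace A :=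
  (negSpace A).orthogonalProjectionOnto ∘L T t ∘L (negSpace A).subtypeL

/-- `T_{-t} p⁻` for `t ≥ 0`, where `T_{-t} = [T_t | H⁻]⁻¹` and `p⁻` is the orthogonal projection
onto `H⁻`. -/
def bwd (A : H →ₗ.[ℝ] H) (T : ℝ → H →L[ℝ] H) (t : ℝ) : H →L[ℝ] H :=
  (negSpace A).subtypeL ∘L (restrNeg A T t).inverse ∘L (negSpace A).orthogonalProjectionOnto

end Unbounded

/-! ### The two-sided canonical Wiener space -/

section Wiener

/-- The space of continuous paths `ω : ℝ → E` with `ω 0 = 0`. -/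
def WienerSpace (E : Type*) [NormedAddCommGroup E] : Type _ := {ω : C(ℝ, E) // ω 0 = 0}

variable {E : Type*} [NormedAddCommGroup E]

/-- The compact-open topology. -/
instance : TopologicalSpace (WienerSpace E) := instTopologicalSpaceSubtype

/-- The Borel `σ`-algebra. -/
instance : MeasurableSpace (WienerSpace E) := borel _

instance : BorelSpace (WienerSpace E) := ⟨rfl⟩

/-- The coordinate process `W(t, ω) = ω t`. -/
def coordProcess (t : ℝ) (ω : WienerSpace E) : E := ω.1 t

/-- The Wiener shift `θ(t, ω)(s) = ω (t + s) - ω t`. -/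
def wienerShift (t : ℝ) (ω : WienerSpace E) : WienerSpace E :=
  ⟨⟨fun s => ω.1 (t + s) - ω.1 t, by fun_prop⟩, by simp⟩

variable [InnerProductSpace ℝ E] [CompleteSpace E] [MeasurableSpace E]
  {K : Type*} [NormedAddCommGroup K] [InnerProductSpace ℝ K] [CompleteSpace K]

/-- `P` is Wiener measure with covariance Hilbert space `K`, embedded into `E` by `j`: under `P`
the coordinate process, indexed by `ℝ`, has independent increments, and `W(t) - W(s)`, `s ≤ t`,
is a centered Gaussian vector of `E` with covariance operator `(t - s) j j*`. -/
structure IsWienerMeasure (j : K →L[ℝ] E) (P : Measure (WienerSpace E)) : Prop where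
  isProbabilityMeasure : IsProbabilityMeasure P
  indep : HasIndepIncrements (coordProcess (E := E)) P
  law : ∀ s t : ℝ, s ≤ t → ∀ x : E,
    P.map (fun ω => ⟪x, coordProcess t ω - coordProcess s ω⟫_ℝ) =
      gaussianReal 0 ((t - s) * ‖j.adjoint x‖ ^ 2).toNNReal

end Wiener

/-! ### Stochastic integrals of deterministic operator-valued integrands -/

section StochasticIntegral

variable {E H K : Type*} [NormedAddCommGroup E] [InnerProductSpace ℝ E]
  [NormedAddCommGroup H] [InnerProductSpace ℝ H]
  [NormedAddCommGroup K] [InnerProductSpace ℝ K] [CompleteSpace K]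

/-- Elementary (step) integrands `∑ᵢ 1_{(aᵢ, bᵢ]} Sᵢ` with `Sᵢ ∈ L(E, H)`. -/
structure ElemIntegrand (E H : Type*) [NormedAddCommGroup E] [InnerProductSpace ℝ E]
    [NormedAddCommGroup H] [InnerProductSpace ℝ H] where
  n : ℕ
  a : Fin n → ℝ
  b : Fin n → ℝ
  le : ∀ i, a i ≤ b i
  S : Fin n → (E →L[ℝ] H)

/-- The value of a step integrand at time `s`. -/
def ElemIntegrand.val (σ : ElemIntegrand E H) (s : ℝ) : E →L[ℝ] H :=
  ∑ i, (Ioc (σ.a i) (σ.b i)).indicator (fun _ => σ.S i) s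

/-- The stochastic integral `∑ᵢ Sᵢ (W(bᵢ) - W(aᵢ))` of a step integrand. -/
def ElemIntegrand.integral (σ : ElemIntegrand E H) (ω : WienerSpace E) : H :=
  ∑ i, σ.S i (coordProcess (σ.b i) ω - coordProcess (σ.a i) ω)

/-- `I` is an everywhere defined Borel measurable version of the stochastic integral
`∫ Φ(s) dW(s)` of `Φ : ℝ → L₂(K, H)`: it is the `L²(P; H)`-limit of the integrals of step
integrands which converge to `Φ` in `L²(ℝ; L₂(K, H))`. -/
def IsStochasticIntegral [MeasurableSpace H] (j : K →L[ℝ] E) (P : Measure (WienerSpace E))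
    (Φ : ℝ → K →L[ℝ] H) (I : WienerSpace E → H) : Prop :=
  Measurable I ∧ ∃ σ : ℕ → ElemIntegrand E H,
    Tendsto (fun n => ∫⁻ s, hsNormSq ((σ n).val s ∘L j - Φ s)) atTop (𝓝 0) ∧
    Tendsto (fun n => ∫⁻ ω, ‖(σ n).integral ω - I ω‖ₑ ^ 2 ∂P) atTop (𝓝 0)

end StochasticIntegral

/-! ### The two-sided integral equation -/

section Equation

variable {E H K : Type*} [NormedAddCommGroup E]
  [NormedAddCommGroup H] [InnerProductSpace ℝ H] [CompleteSpace H]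
  [NormedAddCommGroup K] [InnerProductSpace ℝ K]

/-- The integrand `s ↦ T_{-s} p⁺ B₀` on `(-∞, 0]`, extended by zero. -/
def fwdNoise (A : H →ₗ.[ℝ] H) (T : ℝ → H →L[ℝ] H) (B₀ : K →L[ℝ] H) : ℝ → K →L[ℝ] H :=
  (Iic 0).indicator fun s => fwd A T (-s) ∘L B₀

/-- The integrand `s ↦ T_{-s} p⁻ B₀` on `[0, ∞)`, extended by zero. -/
def bwdNoise (A : H →ₗ.[ℝ] H) (T : ℝ → H →L[ℝ] H) (B₀ : K →L[ℝ] H) : ℝ → K →L[ℝ] H :=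
  (Ici 0).indicator fun s => bwd A T s ∘L B₀

/-- `Y` solves, for every `ω`, the two-sided integral equation
`Y(ω) = ∫_{-∞}^0 T_{-s} p⁺ F(Y(θ(s,ω))) ds - ∫_0^∞ T_{-s} p⁻ F(Y(θ(s,ω))) ds + Ip(ω) - Im(ω)`,
both Bochner integrals being convergent. -/
def SolvesTwoSidedEquation (A : H →ₗ.[ℝ] H) (T : ℝ → H →L[ℝ] H) (F : H → H)
    (Ip Im Y : WienerSpace E → H) : Prop :=
  ∀ ω, IntegrableOn (fun s => fwd A T (-s) (F (Y (wienerShift s ω)))) (Iic 0) ∧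
    IntegrableOn (fun s => bwd A T s (F (Y (wienerShift s ω)))) (Ici 0) ∧
    Y ω = (∫ s in Iic 0, fwd A T (-s) (F (Y (wienerShift s ω))))
      - (∫ s in Ici 0, bwd A T s (F (Y (wienerShift s ω)))) + Ip ω - Im ω

end Equation

end

/-!
# Stationary solutions of a semilinear equation with hyperbolic linear part

In the orthonormal eigenbasis `e n` of `A` everything linear is diagonal: `T_t p⁺` has the entries
`e^{-μ_n t}` for `μ_n > 0` (`inner_fwd`) and `T_{-t} p⁻` the entries `e^{μ_n t}` for `μ_n < 0`
(`inner_bwd`). Both families therefore decay exponentially, with the rates `μpos` and `-μneg`.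

*Stochastic integrals.* The covariance of two increments of the Wiener process is proportional to
the length of the overlap of their intervals (`integral_increment_mul_increment`), which gives the
Itô isometry for step integrands (`IsWienerMeasure.lintegral_integral_sq`). The adjoints of the
integrands map `e n` to `f n s • B₀* (e n)` with scalar functions `f n` dominated in `L²(ℝ)` by an
exponential, and `∑ ‖B₀* (e n)‖²` is the squared Hilbert–Schmidt norm of `B₀`. Such an integrand is
a limit of step integrands (`exists_elemIntegrand_approx`): finitely many `n` suffice, step
functions are dense in `L²(ℝ)`, and `j*` has dense range because `j` is injective. The isometry and
the completeness of `L²(P; H)` provide the integral.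

*The equation.* It is a fixed point equation for `Y`. The right-hand side preserves measurability,
since the shift is jointly continuous in time and path. As `F` is bounded, the values of the
right-hand side at any two maps are at bounded distance from each other, whatever the versions of
the stochastic integrals; and it contracts the uniform distance by
`L (1 / μpos - 1 / μneg) < 1`. The Picard iterates thus converge uniformly, to the only fixed point
(`existsUnique_measurable_fixedPoint`).
-/

/-! ### Vectors and operators in coordinates of an orthonormal basis -/

section Coordinates

variable {H : Type*} [NormedAddCommGroup H] [InnerProductSpace ℝ H] {ι : Type*}

theorem HilbertBasis.ext_inner (e : HilbertBasis ι ℝ H) {x y : H}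
    (h : ∀ n, ⟪e n, x⟫_ℝ = ⟪e n, y⟫_ℝ) : x = y := by
  apply e.repr.injective
  ext n
  simpa only [e.repr_apply_apply] using h n

theorem HilbertBasis.norm_le_of_abs_inner_le [CompleteSpace H] (e : HilbertBasis ι ℝ H)
    {x y : H} {M : ℝ} (hM : 0 ≤ M)
    (h : ∀ n, |⟪e n, y⟫_ℝ| ≤ M * |⟪e n, x⟫_ℝ|) : ‖y‖ ≤ M * ‖x‖ := by
  have key : ‖y‖ₑ ^ 2 ≤ (ENNReal.ofReal M * ‖x‖ₑ) ^ 2 := by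
    rw [mul_pow, enorm_sq_eq_tsum_inner e y, enorm_sq_eq_tsum_inner e x, ← ENNReal.tsum_mul_left]
    refine ENNReal.tsum_le_tsum fun n => ?_
    rw [← mul_pow]
    gcongr
    rw [Real.enorm_eq_ofReal_abs, Real.enorm_eq_ofReal_abs, ← ENNReal.ofReal_mul hM]
    exact ENNReal.ofReal_le_ofReal (h n)
  rw [ENNReal.pow_le_pow_left_iff two_ne_zero, ← ofReal_norm, ← ofReal_norm,
    ← ENNReal.ofReal_mul hM, ENNReal.ofReal_le_ofReal_iff (by positivity)] at key
  exact key

/-- Bounded diagonal multipliers act on a Hilbert space. -/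
theorem HilbertBasis.exists_inner_eq_mul (e : HilbertBasis ι ℝ H) {f : ι → ℝ} {M : ℝ}
    (hf : ∀ n, |f n| ≤ M) (y : H) : ∃ x : H, ∀ n, ⟪e n, x⟫_ℝ = f n * ⟪e n, y⟫_ℝ := by
  have hy : Summable fun n => ‖e.repr y n‖ ^ (2 : ℝ≥0∞).toReal :=
    (memℓp_gen_iff (by norm_num)).1 (lp.memℓp (e.repr y))
  have hx : Memℓp (fun n => f n * e.repr y n) 2 := by
    refine memℓp_gen (.of_nonneg_of_le (fun n => by positivity) (fun n => ?_)
      (hy.mul_left (M ^ (2 : ℝ≥0∞).toReal)))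
    rw [norm_mul, Real.mul_rpow (norm_nonneg _) (norm_nonneg _)]
    gcongr
    exact hf n
  refine ⟨e.repr.symm ⟨_, hx⟩, fun n => ?_⟩
  rw [← e.repr_apply_apply, ← e.repr_apply_apply, LinearIsometryEquiv.apply_symm_apply]

theorem HilbertBasis.measurable_of_inner [MeasurableSpace H] [BorelSpace H]
    [SecondCountableTopology H] [Countable ι] (e : HilbertBasis ι ℝ H) {X : Type*}
    [MeasurableSpace X] {g : X → H} (h : ∀ n, Measurable fun a => ⟪e n, g a⟫_ℝ) :
    Measurable g := by
  refine measurable_of_tendsto_metrizable' (atTop : Filter (Finset ι))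
    (f := fun s a => ∑ n ∈ s, ⟪e n, g a⟫_ℝ • e n) (fun s => ?_) ?_
  · exact Finset.measurable_fun_sum _ fun n _ => (h n).smul_const _
  · rw [tendsto_pi_nhds]
    intro a
    have := e.hasSum_repr (g a)
    simpa only [HasSum, e.repr_apply_apply, SummationFilter.unconditional_filter] using this

end Coordinates

/-! ### The semigroup and the spectral projections in the eigenbasis -/

section Spectral

variable {H : Type*} [NormedAddCommGroup H] [InnerProductSpace ℝ H]

/-- An eigenvector of `A` evolves under the semigroup generated by `-A` by the scalar `e^{-lt}`:
the function `t ↦ e^{lt} T_t x` is continuous with vanishing right derivative. -/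
theorem IsC0SemigroupGeneratedBy.apply_eigenvector {T : ℝ → H →L[ℝ] H} {A : H →ₗ.[ℝ] H}
    (hT : IsC0SemigroupGeneratedBy T (-A)) {l : ℝ} {x : H} (hx : IsEigenpair A l x)
    {t : ℝ} (ht : 0 ≤ t) : T t x = Real.exp (-l * t) • x := by
  have hgen : Tendsto (fun t : ℝ => t⁻¹ • (T t x - x)) (𝓝[>] 0) (𝓝 (-(l • x))) := by
    rw [← hT.generator, LinearPMap.neg_graph]
    exact ⟨(x, l • x), hx, by simp⟩
  have hder : ∀ r, 0 ≤ r → HasDerivWithinAt (fun r => T r x) (T r (-(l • x))) (Ici r) r := by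
    intro r hr
    rw [← hasDerivWithinAt_Ioi_iff_Ici, hasDerivWithinAt_iff_tendsto_slope' (by simp)]
    have h1 : Tendsto (fun s => s - r) (𝓝[>] r) (𝓝[>] 0) := by
      refine tendsto_nhdsWithin_iff.2 ⟨?_, ?_⟩
      · have : Tendsto (fun s => s - r) (𝓝 r) (𝓝 (r - r)) :=
          (continuous_id.sub continuous_const).tendsto r
        rw [sub_self] at this
        exact this.mono_left nhdsWithin_le_nhds
      · filter_upwards [self_mem_nhdsWithin] with s hs
        exact mem_Ioi.2 (sub_pos.2 (mem_Ioi.1 hs))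
    refine (((T r).continuous.tendsto _).comp (hgen.comp h1)).congr' ?_
    filter_upwards [self_mem_nhdsWithin] with s hs
    have hs' : r ≤ s := le_of_lt hs
    have : T s x = T r (T (s - r) x) := by
      rw [← ContinuousLinearMap.comp_apply, ← hT.add r (s - r) hr (sub_nonneg.2 hs'),
        add_sub_cancel]
    simp only [Function.comp_apply, slope_def_module, map_smul, map_sub, this]
  have hconst := constant_of_has_deriv_right_zero (a := 0) (b := t)
    (f := fun r => Real.exp (l * r) • T r x)
    ((by fun_prop : Continuous fun r : ℝ => Real.exp (l * r)).continuousOn.smul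
      ((hT.continuousOn x).mono Icc_subset_Ici_self)) (fun r hr => by
      have he : HasDerivWithinAt (fun r => Real.exp (l * r)) (Real.exp (l * r) * l) (Ici r) r := by
        have := ((hasDerivAt_id r).const_mul l).exp
        simpa using this.hasDerivWithinAt
      have := he.smul (hder r hr.1)
      convert! this using 1
      simp only [map_neg, map_smul, smul_neg, smul_smul]
      rw [neg_add_cancel]) t ⟨ht, le_rfl⟩
  simp only [mul_zero, Real.exp_zero, one_smul, hT.zero, ContinuousLinearMap.id_apply] at hconst
  nth_rw 2 [← hconst]
  rw [smul_smul, ← Real.exp_add]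
  simp

theorem IsC0SemigroupGeneratedBy.inner_apply {T : ℝ → H →L[ℝ] H} {A : H →ₗ.[ℝ] H} {ι : Type*}
    {e : HilbertBasis ι ℝ H} {μ : ι → ℝ} (hT : IsC0SemigroupGeneratedBy T (-A))
    (he : ∀ n, IsEigenpair A (μ n) (e n)) {t : ℝ} (ht : 0 ≤ t) (n : ι) (x : H) :
    ⟪e n, T t x⟫_ℝ = Real.exp (-μ n * t) * ⟪e n, x⟫_ℝ := by
  have h1 := ((e.hasSum_repr x).mapL (T t)).mapL (innerSL ℝ (e n))
  refine h1.unique ?_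
  have h2 := (((e.hasSum_repr x).mapL (innerSL ℝ (e n))).mul_left (Real.exp (-μ n * t)))
  refine h2.congr_fun fun k => ?_
  simp only [map_smul, hT.apply_eigenvector (he k) ht, innerSL_apply_apply, smul_eq_mul]
  by_cases hk : n = k
  · subst hk; ring
  · rw [e.orthonormal.2 hk]; ring

variable [CompleteSpace H]

/-- Eigenvectors of a self-adjoint operator with different eigenvalues are orthogonal. -/
theorem IsEigenpair.inner_eq_zero {A : H →ₗ.[ℝ] H} (hA : IsSelfAdjoint A) {l m : ℝ} {x y : H}
    (hx : IsEigenpair A l x) (hy : IsEigenpair A m y) (hlm : l ≠ m) : ⟪x, y⟫_ℝ = 0 := by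
  have hsymm : A.IsFormalAdjoint A := by
    have := LinearPMap.adjoint_isFormalAdjoint hA.dense_domain
    rwa [LinearPMap.isSelfAdjoint_def.1 hA] at this
  obtain ⟨x', hx1, hx2⟩ := (LinearPMap.mem_graph_iff A).1 hx
  obtain ⟨y', hy1, hy2⟩ := (LinearPMap.mem_graph_iff A).1 hy
  have h := hsymm x' y'
  simp only at hx1 hx2 hy1 hy2
  rw [hx2, hy2, hx1, hy1, inner_smul_left, inner_smul_right] at h
  have : (l - m) * ⟪x, y⟫_ℝ = 0 := by simpa [sub_mul, sub_eq_zero] using h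
  exact (mul_eq_zero.1 this).resolve_left (sub_ne_zero.2 hlm)

variable {A : H →ₗ.[ℝ] H} {ι : Type*} {e : HilbertBasis ι ℝ H} {μ : ι → ℝ}

/-- The closed span of the eigenvectors whose eigenvalue satisfies a condition `p` is the space of
vectors whose coordinates along the other elements of the eigenbasis vanish. -/
theorem inner_eq_zero_of_mem_eigenspan {p : ℝ → Prop} (hA : IsSelfAdjoint A)
    (he : ∀ n, IsEigenpair A (μ n) (e n)) {x : H}
    (hx : x ∈ (Submodule.span ℝ {x | ∃ l, p l ∧ IsEigenpair A l x}).topologicalClosure) {n : ι}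
    (hn : ¬ p (μ n)) : ⟪e n, x⟫_ℝ = 0 := by
  have hle : (Submodule.span ℝ {x | ∃ l, p l ∧ IsEigenpair A l x}).topologicalClosure
      ≤ (innerSL ℝ (e n)).ker := by
    refine Submodule.topologicalClosure_minimal _ (Submodule.span_le.2 ?_)
      (ContinuousLinearMap.isClosed_ker _)
    rintro y ⟨l, hl, hy⟩
    exact (he n).inner_eq_zero hA hy (fun h => hn (h ▸ hl))
  exact hle hx

theorem inner_starProjection_eigenspan {p : ℝ → Prop} [DecidablePred p] (hA : IsSelfAdjoint A)
    (he : ∀ n, IsEigenpair A (μ n) (e n)) (n : ι) (x : H) :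
    ⟪e n, (Submodule.span ℝ
      {x | ∃ l, p l ∧ IsEigenpair A l x}).topologicalClosure.starProjection x⟫_ℝ =
      if p (μ n) then ⟪e n, x⟫_ℝ else 0 := by
  split_ifs with hn
  · have hmem : e n ∈ (Submodule.span ℝ {x | ∃ l, p l ∧ IsEigenpair A l x}).topologicalClosure :=
      Submodule.le_topologicalClosure _ (Submodule.subset_span ⟨_, hn, he n⟩)
    rw [← Submodule.inner_starProjection_left_eq_right,
      Submodule.starProjection_eq_self_iff.2 hmem]
  · exact inner_eq_zero_of_mem_eigenspan hA he (Submodule.starProjection_apply_mem _ _) hn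

theorem mem_eigenspan_of_inner_eq_zero {p : ℝ → Prop} (hA : IsSelfAdjoint A)
    (he : ∀ n, IsEigenpair A (μ n) (e n)) {x : H} (hx : ∀ n, ¬ p (μ n) → ⟪e n, x⟫_ℝ = 0) :
    x ∈ (Submodule.span ℝ {x | ∃ l, p l ∧ IsEigenpair A l x}).topologicalClosure := by
  classical
  rw [← Submodule.starProjection_eq_self_iff]
  refine e.ext_inner fun n => ?_
  rw [inner_starProjection_eigenspan hA he]
  split_ifs with hn
  · rfl
  · exact (hx n hn).symm

variable {T : ℝ → H →L[ℝ] H}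

theorem inner_fwd (hA : IsSelfAdjoint A) (hT : IsC0SemigroupGeneratedBy T (-A))
    (he : ∀ n, IsEigenpair A (μ n) (e n)) {t : ℝ} (ht : 0 ≤ t) (n : ι) (x : H) :
    ⟪e n, fwd A T t x⟫_ℝ = if 0 < μ n then Real.exp (-μ n * t) * ⟪e n, x⟫_ℝ else 0 := by
  rw [fwd, ContinuousLinearMap.comp_apply, hT.inner_apply he ht,
    inner_starProjection_eigenspan hA he, mul_ite, mul_zero]

/-- On `H⁻` the operator `T_t` is bijective, since `e^{μ_n t}` is bounded over the indices with
`μ_n < 0`; so `T_{-t} p⁻` is the diagonal operator with entries `e^{μ_n t}`. -/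
theorem inner_bwd (hA : IsSelfAdjoint A) (hT : IsC0SemigroupGeneratedBy T (-A))
    (he : ∀ n, IsEigenpair A (μ n) (e n)) {t : ℝ} (ht : 0 ≤ t) (n : ι) (x : H) :
    ⟪e n, bwd A T t x⟫_ℝ = if μ n < 0 then Real.exp (μ n * t) * ⟪e n, x⟫_ℝ else 0 := by
  have hR : ∀ (y : negSpace A) n, ⟪e n, (restrNeg A T t y : H)⟫_ℝ =
      Real.exp (-μ n * t) * ⟪e n, (y : H)⟫_ℝ := by
    intro y n
    have h1 : (restrNeg A T t y : H) = (negSpace A).starProjection (T t y) := rfl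
    rw [h1, inner_starProjection_eigenspan hA he, hT.inner_apply he ht]
    split_ifs with hn
    · rfl
    · rw [inner_eq_zero_of_mem_eigenspan hA he y.2 hn, mul_zero]
  have hbij : Function.Bijective (restrNeg A T t) := by
    constructor
    · intro y z hyz
      refine Subtype.ext (e.ext_inner fun n => ?_)
      have := hR y n
      rw [hyz, hR z n] at this
      exact (mul_left_cancel₀ (Real.exp_pos _).ne' this).symm
    · intro z
      obtain ⟨y, hy⟩ := e.exists_inner_eq_mul (M := 1)
        (f := fun n => if μ n < 0 then Real.exp (μ n * t) else 0) (fun n => by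
          split_ifs with hn
          · rw [abs_of_pos (Real.exp_pos _), Real.exp_le_one_iff]
            exact mul_nonpos_of_nonpos_of_nonneg hn.le ht
          · simp) (z : H)
      have hmem : y ∈ negSpace A := mem_eigenspan_of_inner_eq_zero hA he fun n hn => by
        rw [hy, if_neg hn, zero_mul]
      refine ⟨⟨y, hmem⟩, Subtype.ext (e.ext_inner fun n => ?_)⟩
      rw [hR, hy]
      split_ifs with hn
      · rw [← mul_assoc, ← Real.exp_add]
        simp
      · rw [inner_eq_zero_of_mem_eigenspan hA he z.2 hn]; ring
  set y : negSpace A := (negSpace A).orthogonalProjectionOnto x with hy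
  have hyn : ⟪e n, (y : H)⟫_ℝ = if μ n < 0 then ⟪e n, x⟫_ℝ else 0 :=
    inner_starProjection_eigenspan hA he n x
  let Φ := ContinuousLinearEquiv.ofBijective (restrNeg A T t)
    (LinearMap.ker_eq_bot.2 hbij.1) (LinearMap.range_eq_top.2 hbij.2)
  have hΦ : restrNeg A T t = Φ := (ContinuousLinearEquiv.coe_ofBijective _ _ _).symm
  have hb : bwd A T t x = (Φ.symm y : H) := by
    rw [bwd, hΦ, ContinuousLinearMap.inverse_equiv]
    rfl
  have h2 := hR (Φ.symm y) n
  have h3 : restrNeg A T t (Φ.symm y) = y := by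
    rw [hΦ]; exact Φ.apply_symm_apply y
  rw [h3, hyn] at h2
  rw [hb]
  have h4 : ⟪e n, (Φ.symm y : H)⟫_ℝ = Real.exp (μ n * t) * (if μ n < 0 then ⟪e n, x⟫_ℝ else 0) := by
    rw [h2, ← mul_assoc, ← Real.exp_add]
    simp
  rw [h4, mul_ite, mul_zero]

theorem norm_fwd_le (hA : IsSelfAdjoint A) (hT : IsC0SemigroupGeneratedBy T (-A))
    (he : ∀ n, IsEigenpair A (μ n) (e n)) {μpos : ℝ} (hpos : ∀ n, 0 < μ n → μpos ≤ μ n)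
    {t : ℝ} (ht : 0 ≤ t) (x : H) : ‖fwd A T t x‖ ≤ Real.exp (-μpos * t) * ‖x‖ := by
  refine e.norm_le_of_abs_inner_le (Real.exp_pos _).le fun n => ?_
  rw [inner_fwd hA hT he ht]
  split_ifs with hn
  · rw [abs_mul, abs_of_pos (Real.exp_pos _)]
    have := hpos n hn
    gcongr
  · rw [abs_zero]; positivity

theorem norm_bwd_le (hA : IsSelfAdjoint A) (hT : IsC0SemigroupGeneratedBy T (-A))
    (he : ∀ n, IsEigenpair A (μ n) (e n)) {μneg : ℝ} (hneg : ∀ n, μ n < 0 → μ n ≤ μneg)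
    {t : ℝ} (ht : 0 ≤ t) (x : H) : ‖bwd A T t x‖ ≤ Real.exp (μneg * t) * ‖x‖ := by
  refine e.norm_le_of_abs_inner_le (Real.exp_pos _).le fun n => ?_
  rw [inner_bwd hA hT he ht]
  split_ifs with hn
  · rw [abs_mul, abs_of_pos (Real.exp_pos _)]
    have := hneg n hn
    gcongr
  · rw [abs_zero]; positivity

end Spectral

/-! ### A pointwise contraction principle for measurable maps -/

section Contraction

variable {Ω H : Type*} [MeasurableSpace Ω] [NormedAddCommGroup H] [CompleteSpace H]
  [MeasurableSpace H] [BorelSpace H]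

/-- A self-map `Ψ` of the measurable maps `Ω → H` which contracts the (possibly infinite) uniform
distance by `q < 1`, and whose values are at bounded uniform distance from each other, has exactly
one fixed point: the uniform limit of the Picard iterates. -/
theorem existsUnique_measurable_fixedPoint (Ψ : (Ω → H) → Ω → H) {q C : ℝ} (hq : q < 1)
    (hq0 : 0 ≤ q) (hmeas : ∀ Y, Measurable Y → Measurable (Ψ Y))
    (hbdd : ∀ Y Z, Measurable Y → Measurable Z → ∀ ω, ‖Ψ Y ω - Ψ Z ω‖ ≤ C)
    (hcontr : ∀ Y Z, Measurable Y → Measurable Z → ∀ M, (∀ ω, ‖Y ω - Z ω‖ ≤ M) →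
      ∀ ω, ‖Ψ Y ω - Ψ Z ω‖ ≤ q * M) :
    ∃! Y : Ω → H, Measurable Y ∧ ∀ ω, Y ω = Ψ Y ω := by
  set y : ℕ → Ω → H := fun n => (Ψ^[n]) (Ψ 0) with hydef
  have hy : ∀ n, y (n + 1) = Ψ (y n) := fun n => Function.iterate_succ_apply' _ _ _
  have hym : ∀ n, Measurable (y n) := by
    intro n
    induction n with
    | zero => exact hmeas 0 measurable_zero
    | succ n ih => rw [hy]; exact hmeas _ ih
  have hdist : ∀ n ω, dist (y n ω) (y (n + 1) ω) ≤ C * q ^ n := by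
    intro n
    induction n with
    | zero =>
      intro ω
      rw [dist_eq_norm, hy, pow_zero, mul_one]
      exact hbdd 0 _ measurable_zero (hym 0) ω
    | succ n ih =>
      intro ω
      rw [dist_eq_norm, hy (n + 1)]
      nth_rw 1 [hy n]
      refine (hcontr _ _ (hym n) (hym (n + 1)) (C * q ^ n)
        (fun ω => (dist_eq_norm _ _).symm.trans_le (ih ω)) ω).trans_eq ?_
      ring
  choose Y hY using fun ω => cauchySeq_tendsto_of_complete
    (cauchySeq_of_le_geometric q C hq fun n => hdist n ω)
  have hYm : Measurable Y :=
    measurable_of_tendsto_metrizable hym (tendsto_pi_nhds.2 hY)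
  have hYn : ∀ n ω, ‖y n ω - Y ω‖ ≤ C * q ^ n / (1 - q) := fun n ω => by
    rw [← dist_eq_norm]
    exact dist_le_of_le_geometric_of_tendsto q C hq (fun n => hdist n ω) (hY ω) n
  have hYfix : ∀ ω, Y ω = Ψ Y ω := fun ω => by
    refine tendsto_nhds_unique ((tendsto_add_atTop_iff_nat 1).2 (hY ω)) ?_
    rw [tendsto_iff_norm_sub_tendsto_zero]
    have hlim := (tendsto_pow_atTop_nhds_zero_of_lt_one hq0 hq).const_mul (q * C / (1 - q))
    rw [mul_zero] at hlim
    refine squeeze_zero (fun _ => norm_nonneg _) (fun n => ?_) hlim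
    rw [hy]
    exact (hcontr _ _ (hym n) hYm _ (hYn n) ω).trans_eq (by ring)
  refine ⟨Y, ⟨hYm, hYfix⟩, ?_⟩
  rintro Z ⟨hZm, hZ⟩
  have hb : ∀ n ω, ‖Z ω - Y ω‖ ≤ C * q ^ n := by
    intro n
    induction n with
    | zero =>
      intro ω
      rw [hZ, hYfix, pow_zero, mul_one]
      exact hbdd _ _ hZm hYm ω
    | succ n ih =>
      intro ω
      rw [hZ, hYfix, pow_succ, mul_comm (q ^ n), mul_left_comm]
      exact hcontr _ _ hZm hYm _ ih ω
  funext ω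
  have := (tendsto_pow_atTop_nhds_zero_of_lt_one hq0 hq).const_mul C
  rw [mul_zero] at this
  exact sub_eq_zero.1 (norm_le_zero_iff.1 (ge_of_tendsto' this fun n => hb n ω))

end Contraction

/-! ### Integral operators along a measurable flow -/

section IntegralOperator

variable {Ω H : Type*} [MeasurableSpace Ω] [NormedAddCommGroup H] [NormedSpace ℝ H]
  [MeasurableSpace H] {ν : Measure ℝ} {U : ℝ → H →L[ℝ] H} {b : ℝ → ℝ} {θ : ℝ → Ω → Ω} {F : H → H}
  {C L : ℝ}

theorem measurable_kernel_comp_flow (hU : ∀ g : ℝ × Ω → H, Measurable g →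
      Measurable fun p : ℝ × Ω => U p.1 (g p))
    (hθ : Measurable fun p : ℝ × Ω => θ p.1 p.2) (hF : Measurable F) {Y : Ω → H}
    (hY : Measurable Y) : Measurable fun p : ℝ × Ω => U p.1 (F (Y (θ p.1 p.2))) :=
  hU _ (hF.comp (hY.comp hθ))

variable [BorelSpace H] [SecondCountableTopology H]

/-- A bounded nonlinearity, read along the flow, is integrable against the kernel `U`. -/
theorem integrable_kernel_comp_flow (hU : ∀ g : ℝ × Ω → H, Measurable g →
      Measurable fun p : ℝ × Ω => U p.1 (g p))
    (hθ : Measurable fun p : ℝ × Ω => θ p.1 p.2) (hF : Measurable F)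
    (hUb : ∀ᵐ s ∂ν, ∀ x, ‖U s x‖ ≤ b s * ‖x‖) (hb : Integrable b ν) (hb0 : 0 ≤ b)
    (hFb : ∀ v, ‖F v‖ ≤ C) {Y : Ω → H} (hY : Measurable Y) (ω : Ω) :
    Integrable (fun s => U s (F (Y (θ s ω)))) ν := by
  refine (hb.mul_const C).mono' ?_ ?_
  · exact ((measurable_kernel_comp_flow hU hθ hF hY).comp
      (measurable_id.prodMk measurable_const)).aestronglyMeasurable
  · filter_upwards [hUb] with s hs
    exact (hs _).trans (mul_le_mul_of_nonneg_left (hFb _) (hb0 s))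

theorem measurable_integral_kernel_comp_flow [SFinite ν] (hU : ∀ g : ℝ × Ω → H, Measurable g →
      Measurable fun p : ℝ × Ω => U p.1 (g p))
    (hθ : Measurable fun p : ℝ × Ω => θ p.1 p.2) (hF : Measurable F) {Y : Ω → H}
    (hY : Measurable Y) : Measurable fun ω => ∫ s, U s (F (Y (θ s ω))) ∂ν := by
  have h := (measurable_kernel_comp_flow hU hθ hF hY).comp measurable_swap
  exact (h.stronglyMeasurable.integral_prod_right' (ν := ν)).measurable

theorem norm_integral_kernel_sub_le (hU : ∀ g : ℝ × Ω → H, Measurable g →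
      Measurable fun p : ℝ × Ω => U p.1 (g p))
    (hθ : Measurable fun p : ℝ × Ω => θ p.1 p.2) (hF : Measurable F)
    (hUb : ∀ᵐ s ∂ν, ∀ x, ‖U s x‖ ≤ b s * ‖x‖) (hb : Integrable b ν) (hb0 : 0 ≤ b)
    (hFb : ∀ v, ‖F v‖ ≤ C) {Y Z : Ω → H} (hY : Measurable Y) (hZ : Measurable Z) {D : ℝ}
    (hD : ∀ ω, ‖F (Y ω) - F (Z ω)‖ ≤ D) (ω : Ω) :
    ‖(∫ s, U s (F (Y (θ s ω))) ∂ν) - ∫ s, U s (F (Z (θ s ω))) ∂ν‖ ≤ (∫ s, b s ∂ν) * D := by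
  rw [← integral_sub (integrable_kernel_comp_flow hU hθ hF hUb hb hb0 hFb hY ω)
    (integrable_kernel_comp_flow hU hθ hF hUb hb hb0 hFb hZ ω), ← integral_mul_const]
  refine norm_integral_le_of_norm_le (hb.mul_const D) ?_
  filter_upwards [hUb] with s hs
  rw [← map_sub]
  exact (hs _).trans (mul_le_mul_of_nonneg_left (hD _) (hb0 s))

end IntegralOperator

/-! ### The Wiener space and its shift -/

section Shift

variable {E : Type*} [NormedAddCommGroup E]

theorem continuous_coordProcess (t : ℝ) : Continuous (coordProcess (E := E) t) :=
  (ContinuousEvalConst.continuous_eval_const t).comp continuous_subtype_val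

theorem coordProcess_zero (ω : WienerSpace E) : coordProcess 0 ω = 0 := ω.2

instance [SecondCountableTopology E] : SecondCountableTopology (WienerSpace E) :=
  TopologicalSpace.Subtype.secondCountableTopology {ω : C(ℝ, E) | ω 0 = 0}

theorem continuous_wienerShift :
    Continuous fun p : ℝ × WienerSpace E => wienerShift p.1 p.2 := by
  refine Continuous.subtype_mk (ContinuousMap.continuous_of_continuous_uncurry _ ?_) _
  have hev : Continuous fun p : WienerSpace E × ℝ => p.1.1 p.2 :=
    (continuous_subtype_val.comp continuous_fst).eval continuous_snd
  exact (hev.comp (f := fun p : (ℝ × WienerSpace E) × ℝ => (p.1.2, p.1.1 + p.2)) (by fun_prop)).sub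
    (hev.comp (f := fun p : (ℝ × WienerSpace E) × ℝ => (p.1.2, p.1.1)) (by fun_prop))

theorem measurable_wienerShift [SecondCountableTopology E] :
    Measurable fun p : ℝ × WienerSpace E => wienerShift p.1 p.2 :=
  continuous_wienerShift.measurable

end Shift

/-! ### Covariances of the increments of the Wiener process -/

section Covariance

variable {E K : Type*} [NormedAddCommGroup E] [InnerProductSpace ℝ E] [CompleteSpace E]
  [MeasurableSpace E]
  [NormedAddCommGroup K] [InnerProductSpace ℝ K] [CompleteSpace K]
  {j : K →L[ℝ] E} {P : Measure (WienerSpace E)}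

theorem IsWienerMeasure.measurePreserving_inner_sub (hP : IsWienerMeasure j P) {s t : ℝ}
    (hst : s ≤ t) (x : E) :
    MeasurePreserving (fun ω => ⟪x, coordProcess t ω - coordProcess s ω⟫_ℝ) P
      (gaussianReal 0 ((t - s) * ‖j.adjoint x‖ ^ 2).toNNReal) where
  measurable := (continuous_const.inner
    ((continuous_coordProcess t).sub (continuous_coordProcess s))).measurable
  map_eq := hP.law s t hst x

theorem IsWienerMeasure.memLp_inner_sub (hP : IsWienerMeasure j P) (s t : ℝ) (x : E) :
    MemLp (fun ω => ⟪x, coordProcess t ω - coordProcess s ω⟫_ℝ) 2 P := by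
  rcases le_total s t with hst | hst
  · exact (memLp_id_gaussianReal 2).comp_measurePreserving (hP.measurePreserving_inner_sub hst x)
  · have := ((memLp_id_gaussianReal 2).comp_measurePreserving
      (hP.measurePreserving_inner_sub hst x)).neg
    refine this.ae_eq (ae_of_all _ fun ω => ?_)
    simp [inner_sub_right]

theorem IsWienerMeasure.integrable_inner_mul_inner (hP : IsWienerMeasure j P) (a b c d : ℝ)
    (x y : E) :
    Integrable (fun ω => ⟪x, coordProcess b ω - coordProcess a ω⟫_ℝ *
      ⟪y, coordProcess d ω - coordProcess c ω⟫_ℝ) P :=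
  (hP.memLp_inner_sub a b x).integrable_mul (hP.memLp_inner_sub c d y)

theorem IsWienerMeasure.integral_inner_sub (hP : IsWienerMeasure j P) {s t : ℝ} (hst : s ≤ t)
    (x : E) : ∫ ω, ⟪x, coordProcess t ω - coordProcess s ω⟫_ℝ ∂P = 0 := by
  have h := (hP.measurePreserving_inner_sub hst x)
  have h2 := integral_map (μ := P) (f := fun r : ℝ => r) h.measurable.aemeasurable
    (by fun_prop)
  rw [h.map_eq, integral_id_gaussianReal] at h2
  exact h2.symm

theorem IsWienerMeasure.integral_inner_sub_sq (hP : IsWienerMeasure j P) {s t : ℝ} (hst : s ≤ t)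
    (x : E) : ∫ ω, ⟪x, coordProcess t ω - coordProcess s ω⟫_ℝ ^ 2 ∂P =
      (t - s) * ‖j.adjoint x‖ ^ 2 := by
  have h := (hP.measurePreserving_inner_sub hst x)
  have h2 := integral_map (μ := P) (f := fun r : ℝ => r ^ 2) h.measurable.aemeasurable
    (by fun_prop)
  rw [h.map_eq] at h2
  have h3 := variance_of_integral_eq_zero
    (μ := gaussianReal 0 ((t - s) * ‖j.adjoint x‖ ^ 2).toNNReal) (X := fun r : ℝ => r) (by fun_prop)
    integral_id_gaussianReal
  rw [variance_fun_id_gaussianReal] at h3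
  rw [← h2, ← h3, Real.coe_toNNReal _ (mul_nonneg (sub_nonneg.2 hst) (by positivity))]

theorem IsWienerMeasure.integral_inner_mul_inner_self (hP : IsWienerMeasure j P) {s t : ℝ}
    (hst : s ≤ t) (x y : E) : ∫ ω, ⟪x, coordProcess t ω - coordProcess s ω⟫_ℝ *
      ⟪y, coordProcess t ω - coordProcess s ω⟫_ℝ ∂P =
      (t - s) * ⟪j.adjoint x, j.adjoint y⟫_ℝ := by
  have h : ∀ ω, ⟪x, coordProcess t ω - coordProcess s ω⟫_ℝ *
      ⟪y, coordProcess t ω - coordProcess s ω⟫_ℝ =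
      (⟪x + y, coordProcess t ω - coordProcess s ω⟫_ℝ ^ 2
        - ⟪x, coordProcess t ω - coordProcess s ω⟫_ℝ ^ 2
        - ⟪y, coordProcess t ω - coordProcess s ω⟫_ℝ ^ 2) / 2 := fun ω => by
    rw [inner_add_left]; ring
  have hi := fun x => (hP.memLp_inner_sub s t x).integrable_sq
  simp_rw [h]
  rw [integral_div, integral_sub ((hi _).sub' (hi _)) (hi _), integral_sub (hi _) (hi _),
    hP.integral_inner_sub_sq hst, hP.integral_inner_sub_sq hst, hP.integral_inner_sub_sq hst,
    map_add, norm_add_sq_real]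
  ring

variable [BorelSpace E]

theorem IsWienerMeasure.integral_inner_mul_inner_adjacent (hP : IsWienerMeasure j P) {r s t : ℝ}
    (hrs : r ≤ s) (hst : s ≤ t) (x y : E) : ∫ ω, ⟪x, coordProcess s ω - coordProcess r ω⟫_ℝ *
      ⟪y, coordProcess t ω - coordProcess s ω⟫_ℝ ∂P = 0 := by
  have h := (hP.indep.indepFun_sub_sub hrs hst).comp (φ := fun v : E => ⟪x, v⟫_ℝ)
    (ψ := fun v : E => ⟪y, v⟫_ℝ) (continuous_const.inner continuous_id).measurable
    (continuous_const.inner continuous_id).measurable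
  have h2 := h.integral_fun_mul_eq_mul_integral
    (hP.memLp_inner_sub r s x).aestronglyMeasurable (hP.memLp_inner_sub s t y).aestronglyMeasurable
  have h3 := hP.integral_inner_sub hrs x
  simp only [Function.comp_apply, Pi.sub_apply] at h2
  rw [h2, h3, zero_mul]

/-- The covariance function of the two-sided Wiener process, pinned at time `0`. -/
theorem IsWienerMeasure.integral_inner_mul_inner_of_le (hP : IsWienerMeasure j P) {s t : ℝ}
    (hst : s ≤ t) (x y : E) : ∫ ω, ⟪x, coordProcess s ω⟫_ℝ * ⟪y, coordProcess t ω⟫_ℝ ∂P =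
      (|s| + |t| - |s - t|) / 2 * ⟪j.adjoint x, j.adjoint y⟫_ℝ := by
  rw [abs_of_nonpos (sub_nonpos.2 hst)]
  rcases le_total 0 s with hs | hs
  · have h : ∀ ω, ⟪x, coordProcess s ω⟫_ℝ * ⟪y, coordProcess t ω⟫_ℝ =
      ⟪x, coordProcess s ω - coordProcess 0 ω⟫_ℝ * ⟪y, coordProcess s ω - coordProcess 0 ω⟫_ℝ +
      ⟪x, coordProcess s ω - coordProcess 0 ω⟫_ℝ * ⟪y, coordProcess t ω - coordProcess s ω⟫_ℝ :=
      fun ω => by simp only [coordProcess_zero, sub_zero, inner_sub_right]; ring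
    simp_rw [h]
    rw [integral_add (hP.integrable_inner_mul_inner _ _ _ _ _ _)
      (hP.integrable_inner_mul_inner _ _ _ _ _ _), hP.integral_inner_mul_inner_self hs,
      hP.integral_inner_mul_inner_adjacent hs hst, abs_of_nonneg hs, abs_of_nonneg (hs.trans hst)]
    ring
  rcases le_total 0 t with ht | ht
  -- the increments over `(s, 0]` and `(0, t]` are independent, and the bracket vanishes
  · have h : ∀ ω, ⟪x, coordProcess s ω⟫_ℝ * ⟪y, coordProcess t ω⟫_ℝ =
      -(⟪x, coordProcess 0 ω - coordProcess s ω⟫_ℝ * ⟪y, coordProcess t ω - coordProcess 0 ω⟫_ℝ) :=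
      fun ω => by simp only [coordProcess_zero, sub_zero, zero_sub, inner_neg_right]; ring
    simp_rw [h]
    rw [integral_neg, hP.integral_inner_mul_inner_adjacent hs ht, abs_of_nonpos hs,
      abs_of_nonneg ht]
    ring
  · have h : ∀ ω, ⟪x, coordProcess s ω⟫_ℝ * ⟪y, coordProcess t ω⟫_ℝ =
      ⟪x, coordProcess 0 ω - coordProcess t ω⟫_ℝ * ⟪y, coordProcess 0 ω - coordProcess t ω⟫_ℝ +
      ⟪x, coordProcess t ω - coordProcess s ω⟫_ℝ * ⟪y, coordProcess 0 ω - coordProcess t ω⟫_ℝ :=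
      fun ω => by
        simp only [coordProcess_zero, zero_sub, inner_neg_right, inner_sub_right]; ring
    simp_rw [h]
    rw [integral_add (hP.integrable_inner_mul_inner _ _ _ _ _ _)
      (hP.integrable_inner_mul_inner _ _ _ _ _ _), hP.integral_inner_mul_inner_self ht,
      hP.integral_inner_mul_inner_adjacent hst ht, abs_of_nonpos hs, abs_of_nonpos ht]
    ring

theorem IsWienerMeasure.integral_inner_mul_inner (hP : IsWienerMeasure j P) (s t : ℝ)
    (x y : E) : ∫ ω, ⟪x, coordProcess s ω⟫_ℝ * ⟪y, coordProcess t ω⟫_ℝ ∂P =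
      (|s| + |t| - |s - t|) / 2 * ⟪j.adjoint x, j.adjoint y⟫_ℝ := by
  rcases le_total s t with h | h
  · exact hP.integral_inner_mul_inner_of_le h x y
  · simp_rw [mul_comm ⟪x, coordProcess s _⟫_ℝ]
    rw [hP.integral_inner_mul_inner_of_le h, real_inner_comm, abs_sub_comm, add_comm |t|]

theorem volume_real_Ioc_inter_Ioc {a b c d : ℝ} (hab : a ≤ b) (hcd : c ≤ d) :
    volume.real (Ioc a b ∩ Ioc c d) = (|b - c| + |a - d| - |b - d| - |a - c|) / 2 := by
  rw [Ioc_inter_Ioc, Real.volume_real_Ioc]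
  rcases abs_cases (b - c) with h1 | h1 <;> rcases abs_cases (a - d) with h2 | h2 <;>
  rcases abs_cases (b - d) with h3 | h3 <;> rcases abs_cases (a - c) with h4 | h4 <;>
  rw [h1.1, h2.1, h3.1, h4.1] <;> grind

/-- The covariance of two increments, over arbitrary intervals, is governed by the length of
their overlap. -/
theorem IsWienerMeasure.integral_increment_mul_increment (hP : IsWienerMeasure j P) {a b c d : ℝ}
    (hab : a ≤ b) (hcd : c ≤ d) (x y : E) :
    ∫ ω, ⟪x, coordProcess b ω - coordProcess a ω⟫_ℝ *
      ⟪y, coordProcess d ω - coordProcess c ω⟫_ℝ ∂P =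
      volume.real (Ioc a b ∩ Ioc c d) * ⟪j.adjoint x, j.adjoint y⟫_ℝ := by
  have hi : ∀ s t, Integrable (fun ω => ⟪x, coordProcess s ω⟫_ℝ * ⟪y, coordProcess t ω⟫_ℝ) P :=
    fun s t => by simpa [coordProcess_zero] using hP.integrable_inner_mul_inner 0 s 0 t x y
  have h : ∀ ω, ⟪x, coordProcess b ω - coordProcess a ω⟫_ℝ *
      ⟪y, coordProcess d ω - coordProcess c ω⟫_ℝ =
      (⟪x, coordProcess b ω⟫_ℝ * ⟪y, coordProcess d ω⟫_ℝ
        - ⟪x, coordProcess b ω⟫_ℝ * ⟪y, coordProcess c ω⟫_ℝ)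
      - (⟪x, coordProcess a ω⟫_ℝ * ⟪y, coordProcess d ω⟫_ℝ
        - ⟪x, coordProcess a ω⟫_ℝ * ⟪y, coordProcess c ω⟫_ℝ) := fun ω => by
    rw [inner_sub_right, inner_sub_right]; ring
  simp_rw [h]
  rw [integral_sub ((hi _ _).sub' (hi _ _)) ((hi _ _).sub' (hi _ _)),
    integral_sub (hi _ _) (hi _ _),
    integral_sub (hi _ _) (hi _ _), volume_real_Ioc_inter_Ioc hab hcd]
  simp only [hP.integral_inner_mul_inner]
  ring

end Covariance

/-! ### Algebra of step integrands -/

section Elementary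

variable {E H K : Type*} [NormedAddCommGroup E] [InnerProductSpace ℝ E]
  [NormedAddCommGroup H] [InnerProductSpace ℝ H]
  [NormedAddCommGroup K] [InnerProductSpace ℝ K]

theorem ElemIntegrand.continuous_integral (σ : ElemIntegrand E H) :
    Continuous σ.integral :=
  continuous_finsetSum _ fun i _ => (σ.S i).continuous.comp
    ((continuous_coordProcess _).sub (continuous_coordProcess _))

/-- The step integrand `σ + τ`: the terms of `σ` followed by those of `τ`. -/
def ElemIntegrand.add (σ τ : ElemIntegrand E H) : ElemIntegrand E H where
  n := σ.n + τ.n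
  a := Fin.append σ.a τ.a
  b := Fin.append σ.b τ.b
  le i := by
    induction i using Fin.addCases with
    | left i => simpa using σ.le i
    | right i => simpa using τ.le i
  S := Fin.append σ.S τ.S

theorem ElemIntegrand.add_val (σ τ : ElemIntegrand E H) (s : ℝ) :
    (σ.add τ).val s = σ.val s + τ.val s := by
  refine (Fin.sum_univ_add (a := σ.n) (b := τ.n) _).trans ?_
  simp only [val, add, Fin.append_left, Fin.append_right]

theorem ElemIntegrand.add_integral (σ τ : ElemIntegrand E H) (ω : WienerSpace E) :
    (σ.add τ).integral ω = σ.integral ω + τ.integral ω := by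
  refine (Fin.sum_univ_add (a := σ.n) (b := τ.n) _).trans ?_
  simp only [integral, add, Fin.append_left, Fin.append_right]

/-- The step integrand `-σ`. -/
def ElemIntegrand.neg (σ : ElemIntegrand E H) : ElemIntegrand E H where
  n := σ.n
  a := σ.a
  b := σ.b
  le := σ.le
  S i := -σ.S i

theorem ElemIntegrand.neg_val (σ : ElemIntegrand E H) (s : ℝ) : σ.neg.val s = -σ.val s := by
  rw [val, val, ← Finset.sum_neg_distrib]
  exact Finset.sum_congr rfl fun i _ =>
    congrFun (indicator_neg' (Ioc (σ.a i) (σ.b i)) fun _ => σ.S i) s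

theorem ElemIntegrand.neg_integral (σ : ElemIntegrand E H) (ω : WienerSpace E) :
    σ.neg.integral ω = -σ.integral ω := by
  rw [integral, integral, ← Finset.sum_neg_distrib]
  rfl

/-- The step integrand without terms. -/
def ElemIntegrand.zero : ElemIntegrand E H where
  n := 0
  a _ := 0
  b _ := 0
  le _ := le_rfl
  S _ := 0

theorem ElemIntegrand.zero_val (s : ℝ) : (zero : ElemIntegrand E H).val s = 0 :=
  Fin.sum_univ_zero _

/-- The squared `L²(ℝ; K)` norm of a step function, as a quadratic form in its values. -/
theorem integral_norm_sum_indicator_sq {κ : Type*} [Fintype κ] (a b : κ → ℝ) (v : κ → K) :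
    Integrable (fun s => ‖∑ i, (Ioc (a i) (b i)).indicator (fun _ => v i) s‖ ^ 2) volume ∧
    ∫ s, ‖∑ i, (Ioc (a i) (b i)).indicator (fun _ => v i) s‖ ^ 2 =
      ∑ i, ∑ k, volume.real (Ioc (a i) (b i) ∩ Ioc (a k) (b k)) * ⟪v i, v k⟫_ℝ := by
  have h : ∀ s, ‖∑ i, (Ioc (a i) (b i)).indicator (fun _ => v i) s‖ ^ 2 =
      ∑ i, ∑ k, (Ioc (a i) (b i) ∩ Ioc (a k) (b k)).indicator (fun _ => ⟪v i, v k⟫_ℝ) s := by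
    intro s
    rw [← real_inner_self_eq_norm_sq, sum_inner]
    refine Finset.sum_congr rfl fun i _ => ?_
    rw [inner_sum]
    refine Finset.sum_congr rfl fun k _ => ?_
    by_cases h1 : s ∈ Ioc (a i) (b i) <;> by_cases h2 : s ∈ Ioc (a k) (b k) <;>
      simp only [indicator_of_mem, indicator_of_notMem, mem_inter_iff, h1, h2, and_true, and_false,
        not_false_eq_true, inner_zero_left, inner_zero_right, and_self]
  have hi : ∀ i k, Integrable ((Ioc (a i) (b i) ∩ Ioc (a k) (b k)).indicator
      (fun _ => ⟪v i, v k⟫_ℝ)) (volume : Measure ℝ) := fun i k =>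
    (integrable_indicator_iff (measurableSet_Ioc.inter measurableSet_Ioc)).2
      (integrableOn_const (ne_top_of_le_ne_top (by simp) (measure_mono inter_subset_left)))
  simp_rw [h]
  refine ⟨integrable_finsetSum _ fun i _ => integrable_finsetSum _ fun k _ => hi i k, ?_⟩
  rw [integral_finsetSum _ fun i _ => integrable_finsetSum _ fun k _ => hi i k]
  refine Finset.sum_congr rfl fun i _ => ?_
  rw [integral_finsetSum _ fun k _ => hi i k]
  refine Finset.sum_congr rfl fun k _ => ?_
  rw [integral_indicator_const _ (measurableSet_Ioc.inter measurableSet_Ioc), smul_eq_mul]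

variable [CompleteSpace H] [CompleteSpace K]

theorem hsNormSq_eq_tsum_adjoint {ι : Type*} (e : HilbertBasis ι ℝ H) (S : K →L[ℝ] H) :
    hsNormSq S = ∑' n, ‖S.adjoint (e n)‖ₑ ^ 2 := by
  obtain ⟨w, b, -⟩ := exists_hilbertBasis ℝ K
  rw [hsNormSq_eq_tsum b, tsum_enorm_sq_eq_adjoint b e]

variable [CompleteSpace E] {j : K →L[ℝ] E}

theorem ElemIntegrand.adjoint_val_comp (σ : ElemIntegrand E H) (s : ℝ) (h : H) :
    (σ.val s ∘L j).adjoint h = ∑ i, (Ioc (σ.a i) (σ.b i)).indicator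
      (fun _ => j.adjoint ((σ.S i).adjoint h)) s := by
  rw [ContinuousLinearMap.adjoint_comp, ContinuousLinearMap.comp_apply, ElemIntegrand.val, map_sum,
    _root_.sum_apply, map_sum]
  refine Finset.sum_congr rfl fun i _ => ?_
  by_cases hs : s ∈ Ioc (σ.a i) (σ.b i)
  · simp only [indicator_of_mem hs]
  · simp only [indicator_of_notMem hs, map_zero, _root_.zero_apply]

end Elementary

/-! ### The Itô isometry for step integrands -/

section Isometry

variable {E H K : Type*} [NormedAddCommGroup E] [InnerProductSpace ℝ E] [CompleteSpace E]
  [MeasurableSpace E] [BorelSpace E]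
  [NormedAddCommGroup K] [InnerProductSpace ℝ K] [CompleteSpace K]
  [NormedAddCommGroup H] [InnerProductSpace ℝ H] [CompleteSpace H]
  {j : K →L[ℝ] E} {P : Measure (WienerSpace E)}

/-- The scalar Itô isometry: both sides are the same quadratic form in the overlaps of the
intervals. -/
theorem IsWienerMeasure.lintegral_sum_increment_sq (hP : IsWienerMeasure j P) {κ : Type*}
    [Fintype κ] (a b : κ → ℝ) (hab : ∀ i, a i ≤ b i) (x : κ → E) :
    ∫⁻ ω, ‖∑ i, ⟪x i, coordProcess (b i) ω - coordProcess (a i) ω⟫_ℝ‖ₑ ^ 2 ∂P =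
      ∫⁻ s, ‖∑ i, (Ioc (a i) (b i)).indicator (fun _ => j.adjoint (x i)) s‖ₑ ^ 2 := by
  obtain ⟨h1, h2⟩ := integral_norm_sum_indicator_sq a b (fun i => j.adjoint (x i))
  have hexp : ∀ ω, ‖∑ i, ⟪x i, coordProcess (b i) ω - coordProcess (a i) ω⟫_ℝ‖ ^ 2 =
      ∑ i, ∑ k, ⟪x i, coordProcess (b i) ω - coordProcess (a i) ω⟫_ℝ *
        ⟪x k, coordProcess (b k) ω - coordProcess (a k) ω⟫_ℝ := fun ω => by
    rw [Real.norm_eq_abs, sq_abs, sq, Finset.sum_mul_sum]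
  have hi : ∀ i k, Integrable (fun ω => ⟪x i, coordProcess (b i) ω - coordProcess (a i) ω⟫_ℝ *
        ⟪x k, coordProcess (b k) ω - coordProcess (a k) ω⟫_ℝ) P :=
    fun i k => hP.integrable_inner_mul_inner _ _ _ _ _ _
  have hint : Integrable (fun ω =>
      ‖∑ i, ⟪x i, coordProcess (b i) ω - coordProcess (a i) ω⟫_ℝ‖ ^ 2) P := by
    simp_rw [hexp]
    exact integrable_finsetSum _ fun i _ => integrable_finsetSum _ fun k _ => hi i k
  have heq : ∫ ω, ‖∑ i, ⟪x i, coordProcess (b i) ω - coordProcess (a i) ω⟫_ℝ‖ ^ 2 ∂P =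
      ∫ s, ‖∑ i, (Ioc (a i) (b i)).indicator (fun _ => j.adjoint (x i)) s‖ ^ 2 := by
    rw [h2]
    simp_rw [hexp]
    rw [integral_finsetSum _ fun i _ => integrable_finsetSum _ fun k _ => hi i k]
    refine Finset.sum_congr rfl fun i _ => ?_
    rw [integral_finsetSum _ fun k _ => hi i k]
    exact Finset.sum_congr rfl fun k _ => hP.integral_increment_mul_increment (hab i) (hab k) _ _
  have hL := ofReal_integral_eq_lintegral_ofReal hint (ae_of_all _ fun ω => by positivity)
  have hR := ofReal_integral_eq_lintegral_ofReal h1 (ae_of_all _ fun ω => by positivity)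
  rw [heq, hR] at hL
  simpa only [ENNReal.ofReal_pow (norm_nonneg _), ofReal_norm] using hL.symm

/-- The Itô isometry, obtained by summing the scalar isometries along an orthonormal basis. -/
theorem IsWienerMeasure.lintegral_integral_sq (hP : IsWienerMeasure j P) {ι : Type*} [Countable ι]
    (e : HilbertBasis ι ℝ H) (σ : ElemIntegrand E H) :
    ∫⁻ ω, ‖σ.integral ω‖ₑ ^ 2 ∂P = ∫⁻ s, hsNormSq (σ.val s ∘L j) := by
  simp_rw [enorm_sq_eq_tsum_inner e (σ.integral _), hsNormSq_eq_tsum_adjoint e]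
  rw [lintegral_tsum, lintegral_tsum]
  · refine tsum_congr fun n => ?_
    simp_rw [σ.adjoint_val_comp, ElemIntegrand.integral, inner_sum,
      ← ContinuousLinearMap.adjoint_inner_left]
    exact hP.lintegral_sum_increment_sq σ.a σ.b σ.le fun i => (σ.S i).adjoint (e n)
  · intro n
    simp_rw [σ.adjoint_val_comp]
    refine StronglyMeasurable.aemeasurable ?_
    refine ((Finset.stronglyMeasurable_fun_sum _ fun i _ =>
      stronglyMeasurable_const.indicator measurableSet_Ioc).enorm.pow_const 2).stronglyMeasurable
  · intro n
    exact ((continuous_const.inner σ.continuous_integral).enorm.measurable.pow_const 2).aemeasurable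

end Isometry

/-! ### Approximation of scalar functions by step functions -/

section Step

theorem lintegral_enorm_sq_eq_eLpNorm_sq {α F : Type*} [MeasurableSpace α] {ν : Measure α}
    [NormedAddCommGroup F] (f : α → F) : ∫⁻ a, ‖f a‖ₑ ^ 2 ∂ν = eLpNorm f 2 ν ^ 2 := by
  have := eLpNorm_nnreal_pow_eq_lintegral (f := f) (μ := ν) (p := 2) two_ne_zero
  simpa using this.symm

theorem ENNReal.add_sq_le (a b : ℝ≥0∞) : (a + b) ^ 2 ≤ 2 * a ^ 2 + 2 * b ^ 2 := by
  have := ENNReal.rpow_add_le_mul_rpow_add_rpow a b (p := 2) (by norm_num)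
  norm_num at this
  rwa [mul_add] at this

theorem enorm_add_sq_le {F : Type*} [NormedAddCommGroup F] (x y : F) :
    ‖x + y‖ₑ ^ 2 ≤ 2 * ‖x‖ₑ ^ 2 + 2 * ‖y‖ₑ ^ 2 :=
  (pow_le_pow_left' (enorm_add_le x y) 2).trans (ENNReal.add_sq_le _ _)

/-- The sum is the step function with the left end point value `g (t i)` on each
`(t i, t (i + 1)]`, and zero elsewhere. -/
theorem sum_indicator_Ioc_succ (g : ℝ → ℝ) {t : ℕ → ℝ} (ht : Monotone t) (N : ℕ) (s : ℝ) :
    (s ∉ Ioc (t 0) (t N) →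
      ∑ i ∈ Finset.range N, (Ioc (t i) (t (i + 1))).indicator (fun _ => g (t i)) s = 0) ∧
    (s ∈ Ioc (t 0) (t N) → ∃ i, s ∈ Ioc (t i) (t (i + 1)) ∧
      ∑ i ∈ Finset.range N, (Ioc (t i) (t (i + 1))).indicator (fun _ => g (t i)) s = g (t i)) := by
  induction N with
  | zero => simp
  | succ N ih =>
    rw [Finset.sum_range_succ]
    have h0 : t 0 ≤ t N := ht (Nat.zero_le N)
    have h1 : t N ≤ t (N + 1) := ht (Nat.le_succ N)
    constructor
    · intro hs
      rw [ih.1 fun h => hs ⟨h.1, h.2.trans h1⟩,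
        indicator_of_notMem fun h => hs ⟨h0.trans_lt h.1, h.2⟩, add_zero]
    · intro hs
      by_cases hN : s ≤ t N
      · obtain ⟨i, hi, hi'⟩ := ih.2 ⟨hs.1, hN⟩
        exact ⟨i, hi, by rw [hi', indicator_of_notMem fun h => h.1.not_ge hN, add_zero]⟩
      · have hs' : s ∈ Ioc (t N) (t (N + 1)) := ⟨not_le.1 hN, hs.2⟩
        exact ⟨N, hs', by rw [ih.1 fun h => hN h.2, indicator_of_mem hs', zero_add]⟩

theorem Continuous.exists_step_approx {g : ℝ → ℝ} (hg : Continuous g) (hgc : HasCompactSupport g)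
    {ε : ℝ≥0∞} (hε : ε ≠ 0) : ∃ (N : ℕ) (t : ℕ → ℝ), Monotone t ∧
      ∫⁻ s, ‖∑ i ∈ Finset.range N, (Ioc (t i) (t (i + 1))).indicator (fun _ => g (t i)) s
        - g s‖ₑ ^ 2 ≤ ε := by
  obtain ⟨M, hM0, hM⟩ : ∃ M : ℝ, 0 < M ∧ ∀ s, s ∉ Ioc (-M) M → g s = 0 := by
    obtain ⟨M, hM0, hM⟩ := hgc.isBounded.subset_ball_lt 0 0
    refine ⟨M, hM0, fun s hs => image_eq_zero_of_notMem_tsupport fun h => hs ?_⟩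
    have := hM h
    rw [mem_ball_zero_iff, Real.norm_eq_abs, abs_lt] at this
    exact ⟨this.1, this.2.le⟩
  obtain ⟨δ, hδ0, hδ⟩ : ∃ δ : ℝ, 0 < δ ∧ ENNReal.ofReal δ ^ 2 * ENNReal.ofReal (2 * M) ≤ ε := by
    have hc : Tendsto (fun δ : ℝ => ENNReal.ofReal δ ^ 2 * ENNReal.ofReal (2 * M)) (𝓝[>] 0)
        (𝓝 (ENNReal.ofReal 0 ^ 2 * ENNReal.ofReal (2 * M))) := by
      refine ENNReal.Tendsto.mul_const ?_ (Or.inr ENNReal.ofReal_ne_top)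
      exact (((ENNReal.continuous_pow 2).comp ENNReal.continuous_ofReal).tendsto 0).mono_left
        nhdsWithin_le_nhds
    rw [ENNReal.ofReal_zero, zero_pow two_ne_zero, zero_mul] at hc
    obtain ⟨δ, h1, h2⟩ := ((hc.eventually_le_const (pos_iff_ne_zero.2 hε)).and
      self_mem_nhdsWithin).exists
    exact ⟨δ, h2, h1⟩
  obtain ⟨η, hη0, hη⟩ := Metric.uniformContinuous_iff.1
    (hgc.uniformContinuous_of_continuous hg) δ hδ0
  obtain ⟨N, hN⟩ := exists_nat_gt (2 * M / η)
  have hN0 : (0 : ℝ) < N := (by positivity : 0 < 2 * M / η).trans hN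
  have hh : 2 * M / N < η := by rwa [div_lt_comm₀ hN0 hη0]
  have hpos : 0 < 2 * M / N := by positivity
  have hmono : Monotone fun i : ℕ => -M + i * (2 * M / N) := fun i k hik => by
    have : (i : ℝ) ≤ k := Nat.cast_le.2 hik
    dsimp only
    gcongr
  refine ⟨N, fun i => -M + i * (2 * M / N), hmono, ?_⟩
  have ht0 : -M + ((0 : ℕ) : ℝ) * (2 * M / N) = -M := by simp
  have htN : -M + (N : ℝ) * (2 * M / N) = M := by field_simp; ring
  have hstep := sum_indicator_Ioc_succ g (t := fun i : ℕ => -M + i * (2 * M / N))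
    hmono N
  simp only [ht0, htN] at hstep
  have hbound : ∀ s, ‖∑ i ∈ Finset.range N, (Ioc (-M + (i : ℝ) * (2 * M / N))
      (-M + ((i + 1 : ℕ) : ℝ) * (2 * M / N))).indicator (fun _ => g (-M + i * (2 * M / N))) s
        - g s‖ₑ ^ 2 ≤ (Ioc (-M) M).indicator (fun _ => ENNReal.ofReal δ ^ 2) s := by
    intro s
    by_cases hs : s ∈ Ioc (-M) M
    · obtain ⟨i, hi, hi'⟩ := (hstep s).2 hs
      rw [hi', indicator_of_mem hs]
      gcongr
      rw [Real.enorm_eq_ofReal_abs]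
      refine ENNReal.ofReal_le_ofReal (le_of_lt ?_)
      rw [← Real.dist_eq]
      refine hη ?_
      rw [Real.dist_eq, abs_sub_comm, abs_of_nonneg (sub_nonneg.2 hi.1.le)]
      have := hi.2
      push_cast at this
      linarith
    · rw [(hstep s).1 hs, hM s hs, indicator_of_notMem hs]
      simp
  refine (lintegral_mono hbound).trans ?_
  rw [lintegral_indicator_const measurableSet_Ioc, Real.volume_Ioc]
  convert! hδ using 3
  ring

/-- Step functions over half-open intervals are dense in `L²(ℝ)`. -/
theorem MeasureTheory.MemLp.exists_step_approx {f : ℝ → ℝ} (hf : MemLp f 2) {ε : ℝ≥0∞}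
    (hε : ε ≠ 0) : ∃ (N : ℕ) (t c : ℕ → ℝ), Monotone t ∧
      ∫⁻ s, ‖∑ i ∈ Finset.range N, (Ioc (t i) (t (i + 1))).indicator (fun _ => c i) s
        - f s‖ₑ ^ 2 ≤ ε := by
  obtain ⟨δ, hδ0, hδ⟩ : ∃ δ : ℝ≥0∞, δ ≠ 0 ∧ 2 * δ + 2 * δ ^ 2 ≤ ε := by
    have hc : Tendsto (fun δ : ℝ≥0∞ => 2 * δ + 2 * δ ^ 2) (𝓝[>] 0) (𝓝 (2 * 0 + 2 * 0 ^ 2)) :=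
      ((((ENNReal.continuous_const_mul (by simp)).add
        ((ENNReal.continuous_const_mul (by simp)).comp (ENNReal.continuous_pow 2))).tendsto
          0).mono_left nhdsWithin_le_nhds)
    rw [zero_pow two_ne_zero, mul_zero, add_zero] at hc
    obtain ⟨δ, h1, h2⟩ := ((hc.eventually_le_const (pos_iff_ne_zero.2 hε)).and
      self_mem_nhdsWithin).exists
    exact ⟨δ, pos_iff_ne_zero.1 h2, h1⟩
  obtain ⟨g, hgc, hfg, hg, -⟩ := hf.exists_hasCompactSupport_eLpNorm_sub_le (by simp) hδ0
  obtain ⟨N, t, ht, hN⟩ := hg.exists_step_approx hgc hδ0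
  refine ⟨N, t, fun i => g (t i), ht, ?_⟩
  have hmeas : Measurable fun s =>
      ∑ i ∈ Finset.range N, (Ioc (t i) (t (i + 1))).indicator (fun _ => g (t i)) s - g s :=
    (Finset.measurable_fun_sum _ fun i _ => measurable_const.indicator measurableSet_Ioc).sub
      hg.measurable
  calc _ ≤ ∫⁻ s, (2 * ‖∑ i ∈ Finset.range N, (Ioc (t i) (t (i + 1))).indicator
        (fun _ => g (t i)) s - g s‖ₑ ^ 2 + 2 * ‖(f - g) s‖ₑ ^ 2) := by
        refine lintegral_mono fun s => ?_
        rw [← enorm_neg ((f - g) s), Pi.sub_apply, neg_sub]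
        refine le_trans (le_of_eq ?_) (enorm_add_sq_le _ _)
        rw [sub_add_sub_cancel]
    _ = 2 * (∫⁻ s, ‖∑ i ∈ Finset.range N, (Ioc (t i) (t (i + 1))).indicator
        (fun _ => g (t i)) s - g s‖ₑ ^ 2) + 2 * eLpNorm (f - g) 2 volume ^ 2 := by
        rw [lintegral_add_left ((hmeas.enorm.pow_const 2).const_mul 2),
          lintegral_const_mul _ (hmeas.enorm.pow_const 2), lintegral_const_mul' _ _ (by simp),
          lintegral_enorm_sq_eq_eLpNorm_sq (f - g)]
    _ ≤ 2 * δ + 2 * δ ^ 2 := by gcongr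
    _ ≤ ε := hδ

end Step

/-! ### Approximation of operator-valued integrands -/

section HilbertSchmidt

variable {H K : Type*} [NormedAddCommGroup H] [InnerProductSpace ℝ H]
  [NormedAddCommGroup K] [InnerProductSpace ℝ K] [CompleteSpace K]

theorem hsNormSq_add_le (S R : K →L[ℝ] H) :
    hsNormSq (S + R) ≤ 2 * hsNormSq S + 2 * hsNormSq R := by
  rw [hsNormSq, hsNormSq, hsNormSq, ← ENNReal.tsum_mul_left, ← ENNReal.tsum_mul_left,
    ← ENNReal.tsum_add]
  exact ENNReal.tsum_le_tsum fun k => by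
    rw [_root_.add_apply]; exact enorm_add_sq_le _ _

theorem hsNormSq_neg (S : K →L[ℝ] H) : hsNormSq (-S) = hsNormSq S := by
  simp only [hsNormSq, _root_.neg_apply, enorm_neg]

end HilbertSchmidt

section Approximation

variable {E H K : Type*} [NormedAddCommGroup E] [InnerProductSpace ℝ E] [CompleteSpace E]
  [NormedAddCommGroup H] [InnerProductSpace ℝ H] [CompleteSpace H]
  [NormedAddCommGroup K] [InnerProductSpace ℝ K] [CompleteSpace K]
  {j : K →L[ℝ] E}

/-- The orthogonal complement of the range of `j*` is the kernel of `j`. -/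
theorem denseRange_adjoint (hj : Function.Injective j) : DenseRange j.adjoint := by
  have h : (j.adjoint.range)ᗮ = ⊥ := by
    rw [ContinuousLinearMap.orthogonal_range, ContinuousLinearMap.adjoint_adjoint]
    exact LinearMap.ker_eq_bot.2 hj
  rw [← Submodule.topologicalClosure_eq_top_iff] at h
  exact Submodule.dense_iff_topologicalClosure_eq_top.2 h

/-- An integrand of the form `s ↦ f(s) ⟨k, ·⟩ e_n` is approximated by step integrands with
values in the multiples of `⟨x, ·⟩ e_n`, where `j* x` is close to `k`. -/
theorem exists_elemIntegrand_approx_rankOne (hj : Function.Injective j) {ι : Type*}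
    (e : HilbertBasis ι ℝ H) (n : ι) {f : ℝ → ℝ} (hf : MemLp f 2) (k : K) {ε : ℝ≥0∞}
    (hε : ε ≠ 0) : ∃ σ : ElemIntegrand E H,
      (∀ m, m ≠ n → ∀ s, (σ.val s ∘L j).adjoint (e m) = 0) ∧
      ∫⁻ s, ‖(σ.val s ∘L j).adjoint (e n) - f s • k‖ₑ ^ 2 ≤ ε := by
  have hε2 : ε / 2 ≠ 0 := (ENNReal.half_pos hε).ne'
  obtain ⟨δ, hδ0, hδ⟩ : ∃ δ : ℝ≥0∞, δ ≠ 0 ∧ 2 * (δ * ‖k‖ₑ ^ 2) ≤ ε / 2 := by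
    have hk : ‖k‖ₑ ^ 2 ≠ ∞ := by simp
    have hc : Tendsto (fun δ : ℝ≥0∞ => 2 * (δ * ‖k‖ₑ ^ 2)) (𝓝[>] 0) (𝓝 (2 * (0 * ‖k‖ₑ ^ 2))) :=
      ((((ENNReal.continuous_const_mul (by simp)).comp
        (ENNReal.continuous_mul_const hk)).tendsto 0).mono_left nhdsWithin_le_nhds)
    rw [zero_mul, mul_zero] at hc
    obtain ⟨δ, h1, h2⟩ := ((hc.eventually_le_const (pos_iff_ne_zero.2 hε2)).and
      self_mem_nhdsWithin).exists
    exact ⟨δ, pos_iff_ne_zero.1 h2, h1⟩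
  obtain ⟨N, t, c, ht, hN⟩ := hf.exists_step_approx hδ0
  set ψ : ℝ → ℝ := fun s =>
    ∑ i ∈ Finset.range N, (Ioc (t i) (t (i + 1))).indicator (fun _ => c i) s with hψdef
  have hψ : MemLp ψ 2 := memLp_finsetSum _ fun i _ =>
    memLp_indicator_const 2 measurableSet_Ioc _ (Or.inr (by simp))
  have hψm : Measurable ψ :=
    Finset.measurable_fun_sum _ fun i _ => measurable_const.indicator measurableSet_Ioc
  set a : ℝ≥0∞ := ∫⁻ s, ‖ψ s‖ₑ ^ 2 with hadef
  have ha : a ≠ ∞ := by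
    rw [hadef, lintegral_enorm_sq_eq_eLpNorm_sq]
    exact ENNReal.pow_ne_top hψ.eLpNorm_ne_top
  obtain ⟨x, hx⟩ : ∃ x : E, 2 * (a * ‖j.adjoint x - k‖ₑ ^ 2) ≤ ε / 2 := by
    have hcont : Continuous fun y : K => 2 * (a * ‖y - k‖ₑ ^ 2) :=
      (ENNReal.continuous_const_mul (by simp)).comp ((ENNReal.continuous_const_mul ha).comp
        ((ENNReal.continuous_pow 2).comp (continuous_id.sub continuous_const).enorm))
    obtain ⟨x, hx⟩ := (denseRange_adjoint hj).exists_mem_open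
      (isOpen_Iio.preimage hcont (t := Iio (ε / 2)))
      ⟨k, by simpa using pos_iff_ne_zero.2 hε2⟩
    exact ⟨x, le_of_lt hx⟩
  let S : ℕ → E →L[ℝ] H := fun i => (innerSL ℝ (c i • x)).smulRight (e n)
  have hS : ∀ i m, (S i).adjoint (e m) = ⟪e m, e n⟫_ℝ • c i • x := by
    intro i m
    refine ext_inner_right ℝ fun y => ?_
    rw [ContinuousLinearMap.adjoint_inner_left]
    simp only [S, ContinuousLinearMap.smulRight_apply, innerSL_apply_apply, inner_smul_right,
      real_inner_smul_left]
    ring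
  let σ : ElemIntegrand E H :=
    { n := N
      a := fun i => t i
      b := fun i => t (i + 1)
      le := fun i => ht (Nat.le_succ _)
      S := fun i => S i }
  refine ⟨σ, fun m hm s => ?_, ?_⟩
  · rw [σ.adjoint_val_comp]
    refine Finset.sum_eq_zero fun i _ => ?_
    simp only [σ, hS, e.orthonormal.2 hm, zero_smul, map_zero, indicator_zero]
  have hσ : ∀ s, (σ.val s ∘L j).adjoint (e n) = ψ s • j.adjoint x := by
    intro s
    rw [σ.adjoint_val_comp]
    simp only [ψ, Finset.sum_smul, Finset.sum_range]
    refine Finset.sum_congr rfl fun i _ => ?_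
    simp only [σ, hS, real_inner_self_eq_norm_sq, e.orthonormal.1, one_pow, one_smul, map_smul]
    rw [indicator_smul_apply, indicator_apply, indicator_apply]
    split_ifs <;> simp
  have hle : ∀ s, ‖(σ.val s ∘L j).adjoint (e n) - f s • k‖ₑ ^ 2 ≤
      2 * (‖ψ s‖ₑ ^ 2 * ‖j.adjoint x - k‖ₑ ^ 2) + 2 * (‖ψ s - f s‖ₑ ^ 2 * ‖k‖ₑ ^ 2) := by
    intro s
    rw [hσ, ← mul_pow, ← mul_pow, ← enorm_smul, ← enorm_smul]
    refine le_trans (le_of_eq ?_) (enorm_add_sq_le _ _)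
    congr 2
    rw [smul_sub, sub_smul]; abel
  calc _ ≤ ∫⁻ s, (2 * (‖ψ s‖ₑ ^ 2 * ‖j.adjoint x - k‖ₑ ^ 2)
          + 2 * (‖ψ s - f s‖ₑ ^ 2 * ‖k‖ₑ ^ 2)) := lintegral_mono hle
    _ = 2 * (a * ‖j.adjoint x - k‖ₑ ^ 2) + 2 * ((∫⁻ s, ‖ψ s - f s‖ₑ ^ 2) * ‖k‖ₑ ^ 2) := by
        rw [lintegral_add_left (((hψm.enorm.pow_const 2).mul_const _).const_mul 2),
          lintegral_const_mul' _ _ (by simp), lintegral_const_mul' _ _ (by simp),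
          lintegral_mul_const' _ _ (by simp), lintegral_mul_const' _ _ (by simp)]
    _ ≤ ε / 2 + 2 * (δ * ‖k‖ₑ ^ 2) := by gcongr
    _ ≤ ε / 2 + ε / 2 := by gcongr
    _ = ε := ENNReal.add_halves ε

/-- Approximation along finitely many basis vectors, with a prescribed error for each. -/
theorem exists_elemIntegrand_approx_finset (hj : Function.Injective j) {ι : Type*}
    (e : HilbertBasis ι ℝ H) {f : ι → ℝ → ℝ} (hf : ∀ n, MemLp (f n) 2) (k : ι → K)
    {ε : ι → ℝ≥0∞} (hε : ∀ n, ε n ≠ 0) (N : Finset ι) : ∃ σ : ElemIntegrand E H,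
      (∀ n, n ∉ N → ∀ s, (σ.val s ∘L j).adjoint (e n) = 0) ∧
      ∀ n ∈ N, ∫⁻ s, ‖(σ.val s ∘L j).adjoint (e n) - f n s • k n‖ₑ ^ 2 ≤ ε n := by
  classical
  induction N using Finset.induction_on with
  | empty => exact ⟨.zero, fun n _ s => by simp [ElemIntegrand.zero_val], by simp⟩
  | insert m N hm ih =>
    obtain ⟨σ, hσ0, hσ⟩ := ih
    obtain ⟨τ, hτ0, hτ⟩ := exists_elemIntegrand_approx_rankOne hj e m (hf m) (k m) (hε m)
    have hadd : ∀ n s, ((σ.add τ).val s ∘L j).adjoint (e n) =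
        (σ.val s ∘L j).adjoint (e n) + (τ.val s ∘L j).adjoint (e n) := fun n s => by
      rw [ElemIntegrand.add_val, ContinuousLinearMap.add_comp, map_add, _root_.add_apply]
    refine ⟨σ.add τ, fun n hn s => ?_, fun n hn => ?_⟩
    · rw [Finset.mem_insert, not_or] at hn
      rw [hadd, hσ0 n hn.2, hτ0 n hn.1, add_zero]
    · simp_rw [hadd]
      by_cases hnm : n = m
      · subst hnm
        simpa only [hσ0 n hm, zero_add] using hτ
      · simpa only [hτ0 n hnm, add_zero] using hσ n (Finset.mem_of_mem_insert_of_ne hn hnm)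

/-- An integrand which is diagonal in an orthonormal basis of `H`, with square-integrably dominated
entries, is an `L²` limit of step integrands: all but finitely many entries are dropped, and the
remaining ones approximated with summable errors. -/
theorem exists_elemIntegrand_approx (hj : Function.Injective j) {ι : Type*} [Countable ι]
    (e : HilbertBasis ι ℝ H) {f : ι → ℝ → ℝ} (hf : ∀ n, Measurable (f n)) {g : ℝ → ℝ≥0∞}
    (hg : ∫⁻ s, g s ≠ ∞) (hfg : ∀ n s, ‖f n s‖ₑ ^ 2 ≤ g s) {k : ι → K}
    (hk : ∑' n, ‖k n‖ₑ ^ 2 ≠ ∞) {Φ : ℝ → K →L[ℝ] H}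
    (hΦ : ∀ s n, (Φ s).adjoint (e n) = f n s • k n) {ε : ℝ≥0∞} (hε : ε ≠ 0) :
    ∃ σ : ElemIntegrand E H, ∫⁻ s, hsNormSq (σ.val s ∘L j - Φ s) ≤ ε := by
  have hε2 : ε / 2 ≠ 0 := (ENNReal.half_pos hε).ne'
  have hfLp : ∀ n, MemLp (f n) 2 := fun n => by
    refine ⟨(hf n).aestronglyMeasurable, ?_⟩
    have h : eLpNorm (f n) 2 volume ^ 2 < ∞ := by
      rw [← lintegral_enorm_sq_eq_eLpNorm_sq]
      exact (lintegral_mono (hfg n)).trans_lt hg.lt_top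
    exact (ENNReal.pow_lt_top_iff (n := 2)).1 h |>.resolve_right two_ne_zero
  obtain ⟨δ, hδ0, hδ⟩ := ENNReal.exists_pos_sum_of_countable' hε2 ι
  obtain ⟨N, hN⟩ : ∃ N : Finset ι, ∑' n : {n // n ∉ N}, (∫⁻ s, g s) * ‖k n‖ₑ ^ 2 ≤ ε / 2 := by
    have := ENNReal.tendsto_tsum_compl_atTop_zero
      (f := fun n => (∫⁻ s, g s) * ‖k n‖ₑ ^ 2) (by
        rw [ENNReal.tsum_mul_left]; exact ENNReal.mul_ne_top hg hk)
    exact (this.eventually_le_const (pos_iff_ne_zero.2 hε2)).exists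
  obtain ⟨σ, hσ0, hσ⟩ := exists_elemIntegrand_approx_finset hj e hfLp k
    (fun n => (hδ0 n).ne') N
  refine ⟨σ, ?_⟩
  have hcoord : ∀ s n, (σ.val s ∘L j - Φ s).adjoint (e n) =
      (σ.val s ∘L j).adjoint (e n) - f n s • k n := fun s n => by
    rw [map_sub, _root_.sub_apply, hΦ]
  simp_rw [hsNormSq_eq_tsum_adjoint e, hcoord]
  have hmeas : ∀ n, StronglyMeasurable fun s =>
      (σ.val s ∘L j).adjoint (e n) - f n s • k n := fun n => by
    simp_rw [σ.adjoint_val_comp]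
    exact (Finset.stronglyMeasurable_fun_sum _ fun i _ =>
      stronglyMeasurable_const.indicator measurableSet_Ioc).sub
      ((hf n).stronglyMeasurable.smul_const _)
  rw [lintegral_tsum fun n => ((hmeas n).enorm.pow_const 2).aemeasurable]
  have hterm : ∀ n, ∫⁻ s, ‖(σ.val s ∘L j).adjoint (e n) - f n s • k n‖ₑ ^ 2 ≤
      δ n + (↑N : Set ι)ᶜ.indicator (fun n => (∫⁻ s, g s) * ‖k n‖ₑ ^ 2) n := by
    intro n
    by_cases hn : n ∈ N
    · exact (hσ n hn).trans le_self_add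
    · rw [indicator_of_mem (by simpa using hn)]
      refine le_trans ?_ le_add_self
      simp_rw [hσ0 n hn, zero_sub, enorm_neg, enorm_smul, mul_pow]
      rw [lintegral_mul_const' _ _ (by simp)]
      gcongr
      exact hfg n _
  calc _ ≤ ∑' n, (δ n + (↑N : Set ι)ᶜ.indicator (fun n => (∫⁻ s, g s) * ‖k n‖ₑ ^ 2) n) :=
        ENNReal.tsum_le_tsum hterm
    _ = ∑' n, δ n + ∑' n : {n // n ∉ N}, (∫⁻ s, g s) * ‖k n‖ₑ ^ 2 := by
        rw [ENNReal.tsum_add, ← tsum_subtype]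
        rfl
    _ ≤ ε / 2 + ε / 2 := by gcongr
    _ = ε := ENNReal.add_halves ε

end Approximation

/-! ### Existence of stochastic integrals -/

section Existence

variable {E H K : Type*} [NormedAddCommGroup E] [InnerProductSpace ℝ E] [CompleteSpace E]
  [MeasurableSpace E] [BorelSpace E]
  [NormedAddCommGroup H] [InnerProductSpace ℝ H] [CompleteSpace H]
  [SecondCountableTopology H] [MeasurableSpace H] [BorelSpace H]
  [NormedAddCommGroup K] [InnerProductSpace ℝ K] [CompleteSpace K]
  {j : K →L[ℝ] E} {P : Measure (WienerSpace E)}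

/-- A square-integrable limit of step integrands has a stochastic integral: by the Itô isometry
the integrals of a fast approximating sequence are Cauchy in `L²(P; H)`. -/
theorem IsWienerMeasure.exists_isStochasticIntegral (hP : IsWienerMeasure j P) {ι : Type*}
    [Countable ι] (e : HilbertBasis ι ℝ H) {Φ : ℝ → K →L[ℝ] H}
    (hmeas : ∀ n, StronglyMeasurable fun s => (Φ s).adjoint (e n))
    (hfin : ∫⁻ s, hsNormSq (Φ s) ≠ ∞)
    (happrox : ∀ ε : ℝ≥0∞, ε ≠ 0 →
      ∃ σ : ElemIntegrand E H, ∫⁻ s, hsNormSq (σ.val s ∘L j - Φ s) ≤ ε) :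
    ∃ I : WienerSpace E → H, IsStochasticIntegral j P Φ I := by
  -- errors `B n ^ 2 / 8` make the distance of the integrals beyond `N` at most `B N / √2 < B N`
  set B : ℕ → ℝ≥0∞ := fun n => 2⁻¹ ^ n with hB
  have hB0 : ∀ n, B n ≠ 0 := fun n => pow_ne_zero _ (by simp)
  have hBtop : ∀ n, B n ≠ ∞ := fun n => ENNReal.pow_ne_top (by simp)
  have hBanti : Antitone B := fun m n hmn => pow_le_pow_right_of_le_one' (by simp) hmn
  choose σ hσ using fun n => happrox (B n ^ 2 / 8)
    (ENNReal.div_ne_zero.2 ⟨pow_ne_zero _ (hB0 n), by simp⟩)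
  have hmeasσ : ∀ σ : ElemIntegrand E H,
      Measurable fun s => hsNormSq (σ.val s ∘L j - Φ s) := fun σ => by
    simp_rw [hsNormSq_eq_tsum_adjoint e, map_sub, _root_.sub_apply, σ.adjoint_val_comp]
    refine Measurable.tsum fun n => StronglyMeasurable.measurable ?_
    exact (((Finset.stronglyMeasurable_fun_sum _ fun i _ =>
      stronglyMeasurable_const.indicator measurableSet_Ioc).sub
      (hmeas n)).enorm.pow_const 2).stronglyMeasurable
  have htri : ∀ (σ : ElemIntegrand E H) (τ : ℝ → K →L[ℝ] H),
      ∫⁻ s, hsNormSq (σ.val s ∘L j - Φ s + τ s) ≤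
        2 * (∫⁻ s, hsNormSq (σ.val s ∘L j - Φ s)) + 2 * ∫⁻ s, hsNormSq (τ s) := fun σ τ => by
    rw [← lintegral_const_mul' 2 _ (by simp), ← lintegral_const_mul' 2 _ (by simp),
      ← lintegral_add_left ((hmeasσ σ).const_mul 2)]
    exact lintegral_mono fun s => hsNormSq_add_le _ _
  have haesm : ∀ σ : ElemIntegrand E H, AEStronglyMeasurable σ.integral P :=
    fun σ => σ.continuous_integral.measurable.aestronglyMeasurable
  have hLp : ∀ n, MemLp (σ n).integral 2 P := fun n => by
    refine ⟨haesm _, ?_⟩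
    have h : eLpNorm (σ n).integral 2 P ^ 2 < ∞ := by
      rw [← lintegral_enorm_sq_eq_eLpNorm_sq, hP.lintegral_integral_sq e]
      have := htri (σ n) Φ
      simp only [sub_add_cancel] at this
      refine this.trans_lt (ENNReal.add_lt_top.2 ⟨ENNReal.mul_lt_top (by simp) ?_,
        ENNReal.mul_lt_top (by simp) hfin.lt_top⟩)
      refine (hσ n).trans_lt (ENNReal.div_lt_top (ENNReal.pow_ne_top (hBtop n)) (by simp))
    exact (ENNReal.pow_lt_top_iff (n := 2)).1 h |>.resolve_right two_ne_zero
  have hcau : ∀ N n m : ℕ, N ≤ n → N ≤ m →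
      eLpNorm ((σ n).integral - (σ m).integral) 2 P < B N := by
    intro N n m hn hm
    have hsub : ((σ n).integral - (σ m).integral) = ((σ n).add (σ m).neg).integral := by
      funext ω
      rw [ElemIntegrand.add_integral, ElemIntegrand.neg_integral, Pi.sub_apply, sub_eq_add_neg]
    rw [← ENNReal.pow_lt_pow_left_iff two_ne_zero, ← lintegral_enorm_sq_eq_eLpNorm_sq, hsub,
      hP.lintegral_integral_sq e]
    have hval : ∀ s, ((σ n).add (σ m).neg).val s ∘L j =
        (σ n).val s ∘L j - Φ s + -((σ m).val s ∘L j - Φ s) := fun s => by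
      rw [ElemIntegrand.add_val, ElemIntegrand.neg_val, ContinuousLinearMap.add_comp,
        ContinuousLinearMap.neg_comp]
      abel
    simp_rw [hval]
    refine (htri (σ n) _).trans_lt ?_
    simp_rw [hsNormSq_neg]
    calc _ ≤ 2 * (B n ^ 2 / 8) + 2 * (B m ^ 2 / 8) := by gcongr <;> exact hσ _
      _ ≤ 2 * (B N ^ 2 / 8) + 2 * (B N ^ 2 / 8) := by
          gcongr <;> exact hBanti ‹_›
      _ = B N ^ 2 / 2 := by
          rw [← add_mul, ← mul_div_assoc, mul_comm, mul_div_assoc, div_eq_mul_inv]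
          congr 1
          rw [show (2 + 2 : ℝ≥0∞) = 4 by norm_num, show (8 : ℝ≥0∞) = 4 * 2 by norm_num,
            ENNReal.mul_inv (by simp) (by simp), ← mul_assoc,
            ENNReal.mul_inv_cancel (by simp) (by simp), one_mul]
      _ < B N ^ 2 := ENNReal.half_lt_self (pow_ne_zero _ (hB0 N)) (ENNReal.pow_ne_top (hBtop N))
  have hBsum : ∑' n, B n ≠ ∞ := by
    rw [ENNReal.tsum_geometric]
    simp
  obtain ⟨I, hI, hlim⟩ := Lp.cauchy_complete_eLpNorm (by norm_num) hLp hBsum hcau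
  refine ⟨hI.1.mk I, hI.1.stronglyMeasurable_mk.measurable, σ, ?_, ?_⟩
  · refine tendsto_of_tendsto_of_tendsto_of_le_of_le tendsto_const_nhds ?_
      (fun _ => zero_le) hσ
    have : Tendsto (fun n => B n ^ 2 / 8) atTop (𝓝 (0 ^ 2 / 8)) :=
      ENNReal.Tendsto.div_const (((ENNReal.continuous_pow 2).tendsto 0).comp
        (ENNReal.tendsto_pow_atTop_nhds_zero_of_lt_one (by simp))) (Or.inr (by simp))
    simpa using this
  · have h2 := ((ENNReal.continuous_pow 2).tendsto 0).comp hlim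
    rw [zero_pow two_ne_zero] at h2
    refine h2.congr fun n => ?_
    rw [Function.comp_apply, ← lintegral_enorm_sq_eq_eLpNorm_sq]
    refine lintegral_congr_ae ?_
    filter_upwards [hI.1.ae_eq_mk] with ω hω
    rw [Pi.sub_apply, hω]

/-- The stochastic integral of an integrand which is diagonal in an orthonormal basis of `H`. -/
theorem IsWienerMeasure.exists_isStochasticIntegral_of_diagonal (hP : IsWienerMeasure j P)
    (hj : Function.Injective j) {ι : Type*} [Countable ι] (e : HilbertBasis ι ℝ H)
    {f : ι → ℝ → ℝ} (hf : ∀ n, Measurable (f n)) {g : ℝ → ℝ≥0∞}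
    (hg : ∫⁻ s, g s ≠ ∞) (hfg : ∀ n s, ‖f n s‖ₑ ^ 2 ≤ g s) {k : ι → K}
    (hk : ∑' n, ‖k n‖ₑ ^ 2 ≠ ∞) {Φ : ℝ → K →L[ℝ] H}
    (hΦ : ∀ s n, (Φ s).adjoint (e n) = f n s • k n) :
    ∃ I : WienerSpace E → H, IsStochasticIntegral j P Φ I := by
  refine hP.exists_isStochasticIntegral e (fun n => ?_) ?_
    fun ε hε => exists_elemIntegrand_approx hj e hf hg hfg hk hΦ hε
  · simp_rw [hΦ]
    exact (hf n).stronglyMeasurable.smul_const _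
  · have hle : ∀ s, hsNormSq (Φ s) ≤ g s * ∑' n, ‖k n‖ₑ ^ 2 := fun s => by
      simp_rw [hsNormSq_eq_tsum_adjoint e, hΦ, enorm_smul, mul_pow]
      rw [← ENNReal.tsum_mul_left]
      exact ENNReal.tsum_le_tsum fun n => mul_le_mul_left (hfg n s) _
    refine ne_top_of_le_ne_top ?_ (lintegral_mono hle)
    rw [lintegral_mul_const' _ _ hk]
    exact ENNReal.mul_ne_top hg hk

end Existence

/-! ### The noise integrands -/

section Noise

variable {H K : Type*} [NormedAddCommGroup H] [InnerProductSpace ℝ H] [CompleteSpace H]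
  [NormedAddCommGroup K] [InnerProductSpace ℝ K] [CompleteSpace K]
  {A : H →ₗ.[ℝ] H} {ι : Type*} {e : HilbertBasis ι ℝ H} {μ : ι → ℝ} {T : ℝ → H →L[ℝ] H}

theorem adjoint_comp_apply_of_inner {D : H →L[ℝ] H} {h : H} {c : ℝ}
    (hD : ∀ x, ⟪h, D x⟫_ℝ = c * ⟪h, x⟫_ℝ) (B : K →L[ℝ] H) :
    (D ∘L B).adjoint h = c • B.adjoint h := by
  refine ext_inner_right ℝ fun y => ?_
  rw [ContinuousLinearMap.adjoint_inner_left, ContinuousLinearMap.comp_apply, hD,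
    real_inner_smul_left, ContinuousLinearMap.adjoint_inner_left]

theorem adjoint_fwdNoise (hA : IsSelfAdjoint A) (hT : IsC0SemigroupGeneratedBy T (-A))
    (he : ∀ n, IsEigenpair A (μ n) (e n)) (B₀ : K →L[ℝ] H) (s : ℝ) (n : ι) :
    (fwdNoise A T B₀ s).adjoint (e n) =
      (Iic 0).indicator (fun s => if 0 < μ n then Real.exp (μ n * s) else 0) s •
        B₀.adjoint (e n) := by
  by_cases hs : s ∈ Iic (0 : ℝ)
  · rw [fwdNoise, indicator_of_mem hs, indicator_of_mem hs]
    refine adjoint_comp_apply_of_inner (fun x => ?_) B₀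
    rw [inner_fwd hA hT he (neg_nonneg.2 hs), neg_mul_neg, ite_mul, zero_mul]
  · rw [fwdNoise, indicator_of_notMem hs, indicator_of_notMem hs, zero_smul, map_zero,
      _root_.zero_apply]

theorem adjoint_bwdNoise (hA : IsSelfAdjoint A) (hT : IsC0SemigroupGeneratedBy T (-A))
    (he : ∀ n, IsEigenpair A (μ n) (e n)) (B₀ : K →L[ℝ] H) (s : ℝ) (n : ι) :
    (bwdNoise A T B₀ s).adjoint (e n) =
      (Ici 0).indicator (fun s => if μ n < 0 then Real.exp (μ n * s) else 0) s •
        B₀.adjoint (e n) := by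
  by_cases hs : s ∈ Ici (0 : ℝ)
  · rw [bwdNoise, indicator_of_mem hs, indicator_of_mem hs]
    refine adjoint_comp_apply_of_inner (fun x => ?_) B₀
    rw [inner_bwd hA hT he hs, ite_mul, zero_mul]
  · rw [bwdNoise, indicator_of_notMem hs, indicator_of_notMem hs, zero_smul, map_zero,
      _root_.zero_apply]

theorem enorm_indicator_sq_le {s : Set ℝ} {φ ψ : ℝ → ℝ} (hφ : ∀ t ∈ s, |φ t| ≤ ψ t) (t : ℝ) :
    ‖s.indicator φ t‖ₑ ^ 2 ≤ s.indicator (fun t => ENNReal.ofReal (ψ t ^ 2)) t := by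
  by_cases ht : t ∈ s
  · rw [indicator_of_mem ht, indicator_of_mem ht, Real.enorm_eq_ofReal_abs,
      ← ENNReal.ofReal_pow (abs_nonneg _)]
    exact ENNReal.ofReal_le_ofReal (pow_le_pow_left₀ (abs_nonneg _) (hφ t ht) 2)
  · simp [indicator_of_notMem ht]

variable {E : Type*} [NormedAddCommGroup E] [InnerProductSpace ℝ E] [CompleteSpace E]
  [MeasurableSpace E] [BorelSpace E] [SecondCountableTopology H] [MeasurableSpace H]
  [BorelSpace H] [Countable ι] {j : K →L[ℝ] E} {P : Measure (WienerSpace E)}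

theorem IsWienerMeasure.exists_integral_fwdNoise (hP : IsWienerMeasure j P)
    (hj : Function.Injective j) (hA : IsSelfAdjoint A) (hT : IsC0SemigroupGeneratedBy T (-A))
    (he : ∀ n, IsEigenpair A (μ n) (e n)) {μpos : ℝ} (hμpos : 0 < μpos)
    (hpos : ∀ n, 0 < μ n → μpos ≤ μ n) {B₀ : K →L[ℝ] H} (hB₀ : IsHilbertSchmidtOp B₀) :
    ∃ I : WienerSpace E → H, IsStochasticIntegral j P (fwdNoise A T B₀) I := by
  refine hP.exists_isStochasticIntegral_of_diagonal hj e
    (f := fun n => (Iic 0).indicator fun s => if 0 < μ n then Real.exp (μ n * s) else 0)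
    (g := (Iic 0).indicator fun s => ENNReal.ofReal (Real.exp (μpos * s) ^ 2))
    (fun n => ?_) ?_ (fun n => enorm_indicator_sq_le fun s hs => ?_)
    (k := fun n => B₀.adjoint (e n)) ?_ (adjoint_fwdNoise hA hT he B₀)
  · refine Measurable.indicator ?_ measurableSet_Iic
    split_ifs <;> fun_prop
  · rw [lintegral_indicator measurableSet_Iic]
    simp_rw [← Real.exp_nat_mul, Nat.cast_ofNat, ← mul_assoc]
    exact (integrableOn_exp_mul_Iic (by positivity) 0).lintegral_lt_top.ne
  · split_ifs with hn
    · rw [abs_of_pos (Real.exp_pos _), Real.exp_le_exp]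
      exact mul_le_mul_of_nonpos_right (hpos n hn) hs
    · rw [abs_zero]; positivity
  · rw [← hsNormSq_eq_tsum_adjoint e]
    exact hB₀.ne

theorem IsWienerMeasure.exists_integral_bwdNoise (hP : IsWienerMeasure j P)
    (hj : Function.Injective j) (hA : IsSelfAdjoint A) (hT : IsC0SemigroupGeneratedBy T (-A))
    (he : ∀ n, IsEigenpair A (μ n) (e n)) {μneg : ℝ} (hμneg : μneg < 0)
    (hneg : ∀ n, μ n < 0 → μ n ≤ μneg) {B₀ : K →L[ℝ] H} (hB₀ : IsHilbertSchmidtOp B₀) :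
    ∃ I : WienerSpace E → H, IsStochasticIntegral j P (bwdNoise A T B₀) I := by
  refine hP.exists_isStochasticIntegral_of_diagonal hj e
    (f := fun n => (Ici 0).indicator fun s => if μ n < 0 then Real.exp (μ n * s) else 0)
    (g := (Ici 0).indicator fun s => ENNReal.ofReal (Real.exp (μneg * s) ^ 2))
    (fun n => ?_) ?_ (fun n => enorm_indicator_sq_le fun s hs => ?_)
    (k := fun n => B₀.adjoint (e n)) ?_ (adjoint_bwdNoise hA hT he B₀)
  · refine Measurable.indicator ?_ measurableSet_Ici
    split_ifs <;> fun_prop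
  · rw [lintegral_indicator measurableSet_Ici, ← restrict_Ioi_eq_restrict_Ici]
    simp_rw [← Real.exp_nat_mul, Nat.cast_ofNat, ← mul_assoc]
    exact (integrableOn_exp_mul_Ioi (by linarith) 0).lintegral_lt_top.ne
  · split_ifs with hn
    · rw [abs_of_pos (Real.exp_pos _), Real.exp_le_exp]
      exact mul_le_mul_of_nonneg_right (hneg n hn) hs
    · rw [abs_zero]; positivity
  · rw [← hsNormSq_eq_tsum_adjoint e]
    exact hB₀.ne

end Noise

/-! ### The two-sided equation as a fixed point problem -/

section FixedPoint

variable {H E : Type*} [NormedAddCommGroup H] [InnerProductSpace ℝ H] [CompleteSpace H]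
  [SecondCountableTopology H] [MeasurableSpace H] [BorelSpace H]
  [NormedAddCommGroup E] [SecondCountableTopology E]
  {A : H →ₗ.[ℝ] H} {ι : Type*} [Countable ι] {e : HilbertBasis ι ℝ H} {μ : ι → ℝ}
  {T : ℝ → H →L[ℝ] H}

/-- For bounded `F` the right-hand sides of the equation for two different maps `Y` differ by a
bounded map, although the noise terms are unbounded; in the uniform distance the right-hand side
contracts by `L (∫₀^∞ e^{-μpos s} ds + ∫₀^∞ e^{μneg s} ds) = L (1/μpos - 1/μneg)`. -/
theorem existsUnique_solvesTwoSidedEquation (hA : IsSelfAdjoint A)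
    (hT : IsC0SemigroupGeneratedBy T (-A)) (he : ∀ n, IsEigenpair A (μ n) (e n))
    {μneg μpos : ℝ} (hμneg : μneg < 0) (hμpos : 0 < μpos)
    (hneg : ∀ n, μ n < 0 → μ n ≤ μneg) (hpos : ∀ n, 0 < μ n → μpos ≤ μ n)
    {F : H → H} {L C : ℝ} (hL : 0 ≤ L) (hFLip : ∀ v₁ v₂, ‖F v₁ - F v₂‖ ≤ L * ‖v₁ - v₂‖)
    (hFb : ∀ v, ‖F v‖ ≤ C) (hcontr : L * (μpos⁻¹ - μneg⁻¹) < 1)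
    {Ip Im : WienerSpace E → H} (hIp : Measurable Ip) (hIm : Measurable Im) :
    ∃! Y : WienerSpace E → H, Measurable Y ∧ SolvesTwoSidedEquation A T F Ip Im Y := by
  have hF : Measurable F := (LipschitzWith.of_dist_le' (K := L) fun x y => by
    rw [dist_eq_norm, dist_eq_norm]; exact hFLip x y).continuous.measurable
  have hθ := measurable_wienerShift (E := E)
  -- `T` is unconstrained at negative times; `|s|` gives kernels which are measurable on all of `ℝ`
  have hUm : ∀ g : ℝ × WienerSpace E → H, Measurable g →
      Measurable fun p : ℝ × WienerSpace E => fwd A T |p.1| (g p) := fun g hg => by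
    refine e.measurable_of_inner fun n => ?_
    simp_rw [inner_fwd hA hT he (abs_nonneg _)]
    split_ifs
    · exact (by fun_prop : Measurable fun p : ℝ × WienerSpace E => Real.exp (-μ n * |p.1|)).mul
        (measurable_const.inner hg)
    · exact measurable_const
  have hVm : ∀ g : ℝ × WienerSpace E → H, Measurable g →
      Measurable fun p : ℝ × WienerSpace E => bwd A T |p.1| (g p) := fun g hg => by
    refine e.measurable_of_inner fun n => ?_
    simp_rw [inner_bwd hA hT he (abs_nonneg _)]
    split_ifs
    · exact (by fun_prop : Measurable fun p : ℝ × WienerSpace E => Real.exp (μ n * |p.1|)).mul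
        (measurable_const.inner hg)
    · exact measurable_const
  have hUb : ∀ᵐ s ∂(volume.restrict (Iic (0 : ℝ))), ∀ x,
      ‖fwd A T |s| x‖ ≤ Real.exp (μpos * s) * ‖x‖ := by
    filter_upwards [ae_restrict_mem measurableSet_Iic] with s hs x
    refine (norm_fwd_le hA hT he hpos (abs_nonneg _) x).trans_eq ?_
    rw [abs_of_nonpos hs, neg_mul_neg]
  have hVb : ∀ᵐ s ∂(volume.restrict (Ici (0 : ℝ))), ∀ x,
      ‖bwd A T |s| x‖ ≤ Real.exp (μneg * s) * ‖x‖ := by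
    filter_upwards [ae_restrict_mem measurableSet_Ici] with s hs x
    refine (norm_bwd_le hA hT he hneg (abs_nonneg _) x).trans_eq ?_
    rw [abs_of_nonneg hs]
  have hUi : Integrable (fun s => Real.exp (μpos * s)) (volume.restrict (Iic (0 : ℝ))) :=
    integrableOn_exp_mul_Iic hμpos 0
  have hVi : Integrable (fun s => Real.exp (μneg * s)) (volume.restrict (Ici (0 : ℝ))) := by
    rw [← restrict_Ioi_eq_restrict_Ici]
    exact integrableOn_exp_mul_Ioi hμneg 0
  have hUint : ∫ s in Iic (0 : ℝ), Real.exp (μpos * s) = μpos⁻¹ := by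
    rw [integral_exp_mul_Iic hμpos]; simp
  have hVint : ∫ s in Ici (0 : ℝ), Real.exp (μneg * s) = -μneg⁻¹ := by
    rw [integral_Ici_eq_integral_Ioi, integral_exp_mul_Ioi hμneg]; simp [neg_div]
  have hexp0 : ∀ a : ℝ, (0 : ℝ → ℝ) ≤ fun s => Real.exp (a * s) := fun a s => (Real.exp_pos _).le
  set Ψ : (WienerSpace E → H) → WienerSpace E → H := fun Y ω =>
    (∫ s in Iic 0, fwd A T |s| (F (Y (wienerShift s ω))))
      - (∫ s in Ici 0, bwd A T |s| (F (Y (wienerShift s ω)))) + Ip ω - Im ω with hΨ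
  have hdiff : ∀ Y Z, Measurable Y → Measurable Z → ∀ D, (∀ ω, ‖F (Y ω) - F (Z ω)‖ ≤ D) →
      ∀ ω, ‖Ψ Y ω - Ψ Z ω‖ ≤ (μpos⁻¹ - μneg⁻¹) * D := by
    intro Y Z hY hZ D hD ω
    have h1 := norm_integral_kernel_sub_le hUm hθ hF hUb hUi (hexp0 μpos) hFb hY hZ hD ω
    have h2 := norm_integral_kernel_sub_le hVm hθ hF hVb hVi (hexp0 μneg) hFb hY hZ hD ω
    rw [hUint] at h1
    rw [hVint] at h2
    rw [sub_eq_add_neg μpos⁻¹, add_mul]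
    refine le_trans (le_of_eq ?_) ((norm_sub_le _ _).trans (add_le_add h1 h2))
    congr 1
    simp only [hΨ]
    abel
  have hgap : 0 < μpos⁻¹ - μneg⁻¹ :=
    sub_pos.2 ((inv_lt_zero.2 hμneg).trans (inv_pos.2 hμpos))
  refine (existsUnique_congr fun Y => and_congr_right fun hY => ?_).1
    (existsUnique_measurable_fixedPoint Ψ (q := L * (μpos⁻¹ - μneg⁻¹))
      (C := (μpos⁻¹ - μneg⁻¹) * (C + C)) hcontr (mul_nonneg hL hgap.le) (fun Y hY => ?_)
      (fun Y Z hY hZ => hdiff Y Z hY hZ _ fun ω =>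
        (norm_sub_le _ _).trans (add_le_add (hFb _) (hFb _)))
      (fun Y Z hY hZ M hM ω => ?_))
  · have hfwd : ∀ ω, EqOn (fun s => fwd A T |s| (F (Y (wienerShift s ω))))
        (fun s => fwd A T (-s) (F (Y (wienerShift s ω)))) (Iic 0) := fun ω s hs => by
      simp only [abs_of_nonpos (mem_Iic.1 hs)]
    have hbwd : ∀ ω, EqOn (fun s => bwd A T |s| (F (Y (wienerShift s ω))))
        (fun s => bwd A T s (F (Y (wienerShift s ω)))) (Ici 0) := fun ω s hs => by
      simp only [abs_of_nonneg (mem_Ici.1 hs)]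
    refine forall_congr' fun ω => ?_
    have h1 : IntegrableOn (fun s => fwd A T |s| (F (Y (wienerShift s ω)))) (Iic 0) :=
      integrable_kernel_comp_flow hUm hθ hF hUb hUi (hexp0 μpos) hFb hY ω
    have h2 : IntegrableOn (fun s => bwd A T |s| (F (Y (wienerShift s ω)))) (Ici 0) :=
      integrable_kernel_comp_flow hVm hθ hF hVb hVi (hexp0 μneg) hFb hY ω
    simp only [hΨ]
    rw [setIntegral_congr_fun measurableSet_Iic (hfwd ω),
      setIntegral_congr_fun measurableSet_Ici (hbwd ω)]
    exact ⟨fun h => ⟨h1.congr_fun (hfwd ω) measurableSet_Iic,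
      h2.congr_fun (hbwd ω) measurableSet_Ici, h⟩, fun h => h.2.2⟩
  · exact (((measurable_integral_kernel_comp_flow hUm hθ hF hY).sub
      (measurable_integral_kernel_comp_flow hVm hθ hF hY)).add hIp).sub hIm
  · refine (hdiff Y Z hY hZ (L * M) (fun ω => (hFLip _ _).trans
      (mul_le_mul_of_nonneg_left (hM ω) hL)) ω).trans_eq ?_
    ring

end FixedPoint

/-! ### Existence of the noise integrals and of the stationary solution -/

theorem proposition4p1
    {H K E : Type*}
    [NormedAddCommGroup H] [InnerProductSpace ℝ H] [CompleteSpace H]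
    [TopologicalSpace.SeparableSpace H] [MeasurableSpace H] [BorelSpace H]
    [NormedAddCommGroup K] [InnerProductSpace ℝ K] [CompleteSpace K]
    [TopologicalSpace.SeparableSpace K]
    [NormedAddCommGroup E] [InnerProductSpace ℝ E] [CompleteSpace E]
    [TopologicalSpace.SeparableSpace E] [MeasurableSpace E] [BorelSpace E]
    -- the Wiener space, with covariance space `K` embedded into `E` by a Hilbert–Schmidt map
    (j : K →L[ℝ] E) (hj : Function.Injective j) (hjHS : IsHilbertSchmidtOp j)
    (P : Measure (WienerSpace E)) (hP : IsWienerMeasure j P)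
    -- the operator `A`, its eigenbasis, and the semigroup generated by `-A`
    (A : H →ₗ.[ℝ] H) (hA : IsSelfAdjoint A)
    (c : ℝ) (hc : ∀ x : A.domain, c * ‖(x : H)‖ ^ 2 ≤ ⟪A x, (x : H)⟫_ℝ)
    {ι : Type*} [Countable ι] (e : HilbertBasis ι ℝ H) (μ : ι → ℝ)
    (he : ∀ n, IsEigenpair A (μ n) (e n)) (hμ : ∀ n, μ n ≠ 0)
    (hAinv : ∃ R : H →L[ℝ] H, IsBoundedInverse A R ∧ IsTraceClassOp R)
    (T : ℝ → H →L[ℝ] H) (hT : IsC0SemigroupGeneratedBy T (-A))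
    -- the largest negative and the smallest positive eigenvalue of `A`
    (μneg μpos : ℝ) (hneg : IsGreatest {l | l < 0 ∧ IsEigenvalue A l} μneg)
    (hpos : IsLeast {l | 0 < l ∧ IsEigenvalue A l} μpos)
    -- the coefficients
    (B₀ : K →L[ℝ] H) (hB₀ : IsHilbertSchmidtOp B₀)
    (F : H → H) (L : ℝ) (hFLip : ∀ v₁ v₂, ‖F v₁ - F v₂‖ ≤ L * ‖v₁ - v₂‖)
    (hFbdd : ∃ C : ℝ, ∀ v, ‖F v‖ ≤ C)
    (hcontr : L * (μpos⁻¹ - μneg⁻¹) < 1) :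
    -- the two stochastic integrals exist, and for all versions of them there is a unique solution
    (∃ Ip : WienerSpace E → H, IsStochasticIntegral j P (fwdNoise A T B₀) Ip) ∧
    (∃ Im : WienerSpace E → H, IsStochasticIntegral j P (bwdNoise A T B₀) Im) ∧
    ∀ Ip Im : WienerSpace E → H,
      IsStochasticIntegral j P (fwdNoise A T B₀) Ip →
      IsStochasticIntegral j P (bwdNoise A T B₀) Im →
      ∃! Y : WienerSpace E → H, Measurable Y ∧ SolvesTwoSidedEquation A T F Ip Im Y := by
  have : SecondCountableTopology H := UniformSpace.secondCountable_of_separable H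
  have : SecondCountableTopology E := UniformSpace.secondCountable_of_separable E
  have hnegn : ∀ n, μ n < 0 → μ n ≤ μneg := fun n hn =>
    hneg.2 ⟨hn, e n, e.orthonormal.ne_zero n, he n⟩
  have hposn : ∀ n, 0 < μ n → μpos ≤ μ n := fun n hn =>
    hpos.2 ⟨hn, e n, e.orthonormal.ne_zero n, he n⟩
  have hL : 0 ≤ L := by
    obtain ⟨x, hx, -⟩ := hpos.1.2
    have h := (norm_nonneg _).trans (hFLip x 0)
    rw [sub_zero] at h
    exact nonneg_of_mul_nonneg_left h (norm_pos_iff.2 hx)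
  obtain ⟨C, hC⟩ := hFbdd
  refine ⟨hP.exists_integral_fwdNoise hj hA hT he hpos.1.1 hposn hB₀,
    hP.exists_integral_bwdNoise hj hA hT he hneg.1.1 hnegn hB₀, fun Ip Im hIp hIm => ?_⟩
  exact existsUnique_solvesTwoSidedEquation hA hT he hneg.1.1 hpos.1.1 hnegn hposn hL hFLip hC
    hcontr hIp.1 hIm.1
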